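/- Let $n\ge 1$, let $\Omega\subset\mathbb R^n$ be open (not necessarily bounded), and let $p:\Omega\times\Omega\to\mathbb R$ be a measurable function with $$1<p_-:=\operatorname*{ess\,inf}_{x,y\in\Omega}p(x,y)\le \operatorname*{ess\,sup}_{x,y\in\Omega}p(x,y)=:p_+<+\infty .$$ Assume that there is a constant $L\ge 1$ such that $$r^{-\operatorname{osc}_{B_r(x)}p(x,\cdot)}\le L\qquad\text{for all }x\in\Omega\text{ and }0<r<\min\{\operatorname{dist}(x,\partial\Omega),1\},$$ where $\operatorname{osc}_{B}f=\sup_B f-\inf_B f$ and $\operatorname{dist}(x,\emptyset)=+\infty$. Assume further that $\Omega$ is a $W^{1,q}$-extension domain for $q=p_+$ and for $q=p_-$; that is, for each of these $q$ there is a constant $C$ such that every $u\in W^{1,q}(\Omega)$ has an extension $v\in W^{1,q}(\mathbb R^n)$ with $v=u$ a.e. in $\Omega$ and $\|v\|_{W^{1,q}(\mathbb R^n)}\le C\|u\|_{W^{1,q}(\Omega)}$. Then for every $u\in W^{1,p_+}(\Omega)\cap W^{1,p_-}(\Omega)$, with weak gradient $\nabla u$ and $\bar p(x):=p(x,x)$,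 $$\lim_{s\nearrow 1}s(1-s)\int_\Omega\int_\Omega\frac{|u(x)-u(y)|^{p(x,y)}}{|x-y|^{n+sp(x,y)}}\,\mathrm dy\,\mathrm dx=\int_\Omega K_{n,\bar p(x)}\,|\nabla u(x)|^{\bar p(x)}\,\mathrm dx<+\infty ,$$ where, for $q>1$, with $\mathcal H^{n-1}$ the surface measure on the unit sphere $\mathbb S^{n-1}$, $$K_{n,q}=\frac1q\int_{\mathbb S^{n-1}}|\omega_n|^{q}\,\mathrm d\mathcal H^{n-1}(\omega)=2\pi^{\frac{n-1}{2}}\,\frac{\Gamma(\frac{q+1}{2})}{\Gamma(\frac{n+q}{2})}\,\frac1q .$$ -/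

import Mathlib

open MeasureTheory Set Filter Topology
open scoped ENNReal NNReal ContDiff

noncomputable section

namespace VarBBM

/-- `G` is the weak (distributional) gradient of `u` on the open set `Ω ⊆ ℝⁿ`: both are locally
integrable on `Ω`, and `∫_Ω u ∂ᵢφ = - ∫_Ω Gᵢ φ` for every test function `φ ∈ C_c^∞(Ω)` and every
index `i`. -/
structure HasWeakGradient {n : ℕ} (Ω : Set (EuclideanSpace ℝ (Fin n)))
    (u : EuclideanSpace ℝ (Fin n) → ℝ)
    (G : EuclideanSpace ℝ (Fin n) → EuclideanSpace ℝ (Fin n)) : Prop where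
  locallyIntegrableOn : LocallyIntegrableOn u Ω volume
  locallyIntegrableOn_grad : LocallyIntegrableOn G Ω volume
  integral_eq : ∀ φ : EuclideanSpace ℝ (Fin n) → ℝ, ContDiff ℝ ∞ φ → HasCompactSupport φ →
    tsupport φ ⊆ Ω → ∀ i : Fin n,
      ∫ x in Ω, u x * fderiv ℝ φ x (EuclideanSpace.single i 1) = - ∫ x in Ω, G x i * φ x

/-- `u ∈ W^{1,q}(Ω)` with weak gradient `G`: `u` and all weak derivatives `Dᵢu = Gᵢ` belong to
`L^q(Ω)`. -/
structure IsSobolevWith {n : ℕ} (Ω : Set (EuclideanSpace ℝ (Fin n))) (q : ℝ≥0∞)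
    (u : EuclideanSpace ℝ (Fin n) → ℝ)
    (G : EuclideanSpace ℝ (Fin n) → EuclideanSpace ℝ (Fin n)) : Prop where
  hasWeakGradient : HasWeakGradient Ω u G
  memLp : MemLp u q (volume.restrict Ω)
  memLp_grad : ∀ i : Fin n, MemLp (fun x => G x i) q (volume.restrict Ω)

/-- `u ∈ W^{1,q}(Ω)`. -/
def MemSobolev {n : ℕ} (Ω : Set (EuclideanSpace ℝ (Fin n))) (q : ℝ≥0∞)
    (u : EuclideanSpace ℝ (Fin n) → ℝ) : Prop :=
  ∃ G : EuclideanSpace ℝ (Fin n) → EuclideanSpace ℝ (Fin n), IsSobolevWith Ω q u G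

/-- The norm `‖u‖_{L^q(Ω)} + ∑ᵢ ‖Dᵢu‖_{L^q(Ω)}` of `W^{1,q}(Ω)`, for `u` with weak gradient `G`. -/
def sobolevNorm {n : ℕ} (Ω : Set (EuclideanSpace ℝ (Fin n))) (q : ℝ≥0∞)
    (u : EuclideanSpace ℝ (Fin n) → ℝ)
    (G : EuclideanSpace ℝ (Fin n) → EuclideanSpace ℝ (Fin n)) : ℝ≥0∞ :=
  eLpNorm u q (volume.restrict Ω) + ∑ i : Fin n, eLpNorm (fun x => G x i) q (volume.restrict Ω)

/-- `Ω` is a `W^{1,q}`-extension domain: for some constant `C`, every `u ∈ W^{1,q}(Ω)` is the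
restriction to `Ω` of some `v ∈ W^{1,q}(ℝⁿ)` with `‖v‖_{W^{1,q}(ℝⁿ)} ≤ C ‖u‖_{W^{1,q}(Ω)}`. -/
def IsExtensionDomain {n : ℕ} (Ω : Set (EuclideanSpace ℝ (Fin n))) (q : ℝ≥0∞) : Prop :=
  ∃ C : ℝ≥0, ∀ (u : EuclideanSpace ℝ (Fin n) → ℝ)
    (G : EuclideanSpace ℝ (Fin n) → EuclideanSpace ℝ (Fin n)), IsSobolevWith Ω q u G →
    ∃ (v : EuclideanSpace ℝ (Fin n) → ℝ)
      (H : EuclideanSpace ℝ (Fin n) → EuclideanSpace ℝ (Fin n)),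
      IsSobolevWith univ q v H ∧ v =ᵐ[volume.restrict Ω] u ∧
        sobolevNorm univ q v H ≤ C * sobolevNorm Ω q u G

/-- `p₋ = ess inf_{Ω × Ω} p`, as an extended nonnegative number.  The truncation of `p` at `0` is
harmless: `1 < p₋` says the same with and without it, and forces `p > 1` almost everywhere. -/
def pMinus {n : ℕ} (Ω : Set (EuclideanSpace ℝ (Fin n)))
    (p : EuclideanSpace ℝ (Fin n) → EuclideanSpace ℝ (Fin n) → ℝ) : ℝ≥0∞ :=
  essInf (fun z : EuclideanSpace ℝ (Fin n) × EuclideanSpace ℝ (Fin n) =>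
    ENNReal.ofReal (p z.1 z.2)) (volume.restrict (Ω ×ˢ Ω))

/-- `p₊ = ess sup_{Ω × Ω} p`, as an extended nonnegative number. -/
def pPlus {n : ℕ} (Ω : Set (EuclideanSpace ℝ (Fin n)))
    (p : EuclideanSpace ℝ (Fin n) → EuclideanSpace ℝ (Fin n) → ℝ) : ℝ≥0∞ :=
  essSup (fun z : EuclideanSpace ℝ (Fin n) × EuclideanSpace ℝ (Fin n) =>
    ENNReal.ofReal (p z.1 z.2)) (volume.restrict (Ω ×ˢ Ω))

/-- The bounds `1 < p₋ ≤ p₊ < ∞`. -/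
def ExponentBounds {n : ℕ} (Ω : Set (EuclideanSpace ℝ (Fin n)))
    (p : EuclideanSpace ℝ (Fin n) → EuclideanSpace ℝ (Fin n) → ℝ) : Prop :=
  1 < pMinus Ω p ∧ pMinus Ω p ≤ pPlus Ω p ∧ pPlus Ω p < ⊤

/-- The oscillation `sup_S f - inf_S f` of a function that is bounded on `S`. -/
def osc {n : ℕ} (f : EuclideanSpace ℝ (Fin n) → ℝ) (S : Set (EuclideanSpace ℝ (Fin n))) : ℝ :=
  sSup (f '' S) - sInf (f '' S)

/-- The log-Hölder condition `r ^ (-osc_{B_r(x)} p(x, ·)) ≤ L` for all `x ∈ Ω` and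
`0 < r < min {dist(x, ∂Ω), 1}`, with some `L ≥ 1`; in particular the oscillation is finite.  The
distance is extended-valued, so that it is `∞` if `∂Ω = ∅`. -/
def LogHolder {n : ℕ} (Ω : Set (EuclideanSpace ℝ (Fin n)))
    (p : EuclideanSpace ℝ (Fin n) → EuclideanSpace ℝ (Fin n) → ℝ) : Prop :=
  ∃ L : ℝ, 1 ≤ L ∧ ∀ x ∈ Ω, ∀ r : ℝ, 0 < r →
    ENNReal.ofReal r < min (Metric.infEDist x (frontier Ω)) 1 →
      Bornology.IsBounded (p x '' Metric.ball x r) ∧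
        r ^ (-osc (p x) (Metric.ball x r)) ≤ L

/-- The modular `s(1-s) ∫_Ω ∫_Ω |u(x)-u(y)|^{p(x,y)} / |x-y|^{n+s p(x,y)} dy dx`. -/
def fracModular {n : ℕ} (Ω : Set (EuclideanSpace ℝ (Fin n)))
    (p : EuclideanSpace ℝ (Fin n) → EuclideanSpace ℝ (Fin n) → ℝ) (s : ℝ)
    (u : EuclideanSpace ℝ (Fin n) → ℝ) : ℝ≥0∞ :=
  ENNReal.ofReal (s * (1 - s)) * ∫⁻ x in Ω, ∫⁻ y in Ω,
    ENNReal.ofReal (|u x - u y| ^ p x y / ‖x - y‖ ^ ((n : ℝ) + s * p x y))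

/-- `K_{n,q} = (1/q) ∫_{S^{n-1}} |ξ_n|^q dσ(ξ)`, where `σ` is the surface measure of the unit
sphere and `ξ_n` is the last coordinate of `ξ`. -/
def bbmConst (n : ℕ) (hn : 0 < n) (q : ℝ) : ℝ :=
  1 / q * ∫ ξ : Metric.sphere (0 : EuclideanSpace ℝ (Fin n)) 1,
    |(ξ : EuclideanSpace ℝ (Fin n)) ⟨n - 1, Nat.sub_one_lt_of_lt hn⟩| ^ q
      ∂(volume : Measure (EuclideanSpace ℝ (Fin n))).toSphere

/-- The limit modular `∫_Ω K_{n,p(x,x)} |G(x)|^{p(x,x)} dx`, to be used with `G = ∇u`. -/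
def gradModular {n : ℕ} (hn : 0 < n) (Ω : Set (EuclideanSpace ℝ (Fin n)))
    (p : EuclideanSpace ℝ (Fin n) → EuclideanSpace ℝ (Fin n) → ℝ)
    (G : EuclideanSpace ℝ (Fin n) → EuclideanSpace ℝ (Fin n)) : ℝ≥0∞ :=
  ∫⁻ x in Ω, ENNReal.ofReal (bbmConst n hn (p x x) * ‖G x‖ ^ p x x)

end VarBBM

end

/-! Write the integrand as `(|u(x)-u(y)|/|x-y|)^p |x-y|^((1-s)p-n)`. After multiplication by `1-s`
the mass concentrates on the diagonal as `s` tends to `1`, so only the infinitesimal behaviour of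
`u` and the diagonal values of `p` survive. Let `a = p₋` and `b = p₊`, and cut at `|x-y| = δ`.

Far part: its integral is bounded uniformly for `1/2 < s < 1` (`lintegral_farKernel_le`), so the
factor `1-s` kills it.

Near part: the difference quotient is compared with `|∇u(x)·(y-x)|/|x-y|`. Extending `u` to the
whole space, the fundamental theorem of calculus along segments and the continuity of translations
in `L^q` make the Taylor error small in `L^q`, for `q = a` and `q = b`, relative to `|h|^q`
(`HasWeakGradient.exists_lintegral_enorm_le`). Since `t^p ≤ t^a + t^b`, and since `(1-s) ∫_{|h|<1}
|h|^((1-s)a-n) dh` does not depend on `s`, the modular of the error is small uniformly in `s`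
(`nearModular_taylorError_le`). A quasi-triangle inequality whose main constant is close to `1`
(`nearModular_le_of_le_add`) transfers limits from the gradient quotient to the difference quotient.

Gradient quotient: for fixed `x`, the log-Hölder condition makes `p(x,·)` continuous at `x`, so near
`x` the exponent may be replaced by `p(x,x) ± η`. Polar coordinates then compute the integral
exactly (`lintegral_ball_gradQuotient`), and continuity of the sphere moment in the exponent allows
`η` to tend to `0`. Dominated convergence in `x`, with a majorant built from `|∇u|^a + |∇u|^b`,
finishes (`tendsto_nearModular_gradQuotient`, `tendsto_fractional_modular`). -/

noncomputable section

namespace VarBBM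

/-! ### Polar coordinates and moments of the unit sphere -/

section Polar

variable {E : Type*} [NormedAddCommGroup E] [InnerProductSpace ℝ E] [FiniteDimensional ℝ E]
  [MeasurableSpace E] [BorelSpace E]

/-- The moment `∫_{S} |⟪g, ξ⟫| ^ q dσ(ξ)` of the surface measure of the unit sphere. -/
def sphereMoment (g : E) (q : ℝ) : ℝ≥0∞ :=
  ∫⁻ ξ : Metric.sphere (0 : E) 1, ENNReal.ofReal (|inner ℝ g (ξ : E)| ^ q)
    ∂(volume : Measure E).toSphere

lemma lintegral_inner_rpow_mul_fun_norm [Nontrivial E] (g : E) (q : ℝ) {f : ℝ → ℝ≥0∞}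
    (hf : Measurable f) :
    ∫⁻ x : E, ENNReal.ofReal (|inner ℝ g x| ^ q) * f ‖x‖ =
      sphereMoment g q *
        ∫⁻ r in Ioi (0 : ℝ), ENNReal.ofReal (r ^ (q + Module.finrank ℝ E - 1)) * f r := by
  have hd : 0 < Module.finrank ℝ E := Module.finrank_pos
  have key := (volume : Measure E).measurePreserving_homeomorphUnitSphereProd.lintegral_comp_emb
    (Homeomorph.measurableEmbedding _)
    (fun z => ENNReal.ofReal (|inner ℝ g (z.1 : E)| ^ q) *
      (ENNReal.ofReal ((z.2 : ℝ) ^ q) * f z.2))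
  rw [lintegral_prod_mul (f := fun ξ : Metric.sphere (0 : E) 1 =>
      ENNReal.ofReal (|inner ℝ g (ξ : E)| ^ q))
      (g := fun r : Ioi (0 : ℝ) => ENNReal.ofReal ((r : ℝ) ^ q) * f r)
      (by fun_prop) (by fun_prop)] at key
  have h1 : ∫⁻ r : Ioi (0 : ℝ), ENNReal.ofReal ((r : ℝ) ^ q) * f r
        ∂(Measure.volumeIoiPow (Module.finrank ℝ E - 1)) =
      ∫⁻ r in Ioi (0 : ℝ), ENNReal.ofReal (r ^ (q + Module.finrank ℝ E - 1)) * f r := by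
    rw [Measure.volumeIoiPow, lintegral_withDensity_eq_lintegral_mul _ (by fun_prop) (by fun_prop),
      ← lintegral_subtype_comap measurableSet_Ioi]
    refine lintegral_congr fun r => ?_
    have hr : (0 : ℝ) < r := r.2
    simp only [Pi.mul_apply]
    rw [← mul_assoc, ← ENNReal.ofReal_mul (by positivity), ← Real.rpow_natCast,
      ← Real.rpow_add hr, Nat.cast_sub hd]
    congr 3
    push_cast
    ring
  have h2 : ∫⁻ x : E, ENNReal.ofReal (|inner ℝ g x| ^ q) * f ‖x‖ =
      ∫⁻ x : ({(0 : E)}ᶜ : Set E), ENNReal.ofReal (|inner ℝ g (x : E)| ^ q) * f ‖(x : E)‖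
        ∂(Measure.comap Subtype.val volume) := by
    rw [lintegral_subtype_comap (measurableSet_singleton _).compl
      (fun x : E => ENNReal.ofReal (|inner ℝ g x| ^ q) * f ‖x‖), restrict_compl_singleton]
  rw [h2, sphereMoment, ← h1, ← key]
  refine lintegral_congr fun x => ?_
  have hx : (0 : ℝ) < ‖(x : E)‖ := norm_pos_iff.2 x.2
  simp only [homeomorphUnitSphereProd_apply_fst_coe, homeomorphUnitSphereProd_apply_snd_coe]
  rw [← mul_assoc, ← ENNReal.ofReal_mul (by positivity),
    ← Real.mul_rpow (by positivity) (by positivity), inner_smul_right, abs_mul, abs_inv, abs_norm,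
    mul_comm (‖(x : E)‖⁻¹), inv_mul_cancel_right₀ hx.ne']

lemma lintegral_rpow_Iio {β ρ : ℝ} (hβ : 0 < β) (hρ : 0 < ρ) :
    ∫⁻ r in Ioi (0 : ℝ), (Iio ρ).indicator (fun r => ENNReal.ofReal (r ^ (β - 1))) r =
      ENNReal.ofReal (ρ ^ β / β) := by
  rw [lintegral_indicator measurableSet_Iio, Measure.restrict_restrict measurableSet_Iio,
    inter_comm, Ioi_inter_Iio, Measure.restrict_congr_set Ioo_ae_eq_Ioc,
    ← ofReal_integral_eq_lintegral_ofReal, ← intervalIntegral.integral_of_le hρ.le,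
    integral_rpow (Or.inl (by linarith))]
  · simp [Real.zero_rpow hβ.ne']
  · exact ((intervalIntegral.intervalIntegrable_rpow' (by linarith)).1)
  · filter_upwards [ae_restrict_mem measurableSet_Ioc] with r hr
    exact Real.rpow_nonneg hr.1.le _

/-- The integral of `|⟪g, x⟫| ^ q ‖x‖ ^ (β - q - d)` over a ball. -/
lemma lintegral_ball_inner_rpow [Nontrivial E] (g : E) (q : ℝ) {β ρ : ℝ} (hβ : 0 < β)
    (hρ : 0 < ρ) :
    ∫⁻ x in Metric.ball (0 : E) ρ, ENNReal.ofReal (|inner ℝ g x| ^ q) *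
        ENNReal.ofReal (‖x‖ ^ (β - q - Module.finrank ℝ E)) =
      sphereMoment g q * ENNReal.ofReal (ρ ^ β / β) := by
  have h := lintegral_inner_rpow_mul_fun_norm g q
    (f := (Iio ρ).indicator fun r => ENNReal.ofReal (r ^ (β - q - Module.finrank ℝ E)))
    (Measurable.indicator (by fun_prop) measurableSet_Iio)
  rw [← lintegral_rpow_Iio hβ hρ, ← lintegral_indicator measurableSet_ball]
  convert h using 1
  · refine lintegral_congr fun x => ?_
    by_cases hx : ‖x‖ < ρ <;> simp [hx]
  · congr 1
    refine setLIntegral_congr_fun measurableSet_Ioi fun r hr => ?_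
    by_cases hx : r < ρ
    · simp only [indicator, mem_Iio, hx, if_true]
      rw [← ENNReal.ofReal_mul (Real.rpow_nonneg (le_of_lt hr) _), ← Real.rpow_add hr]
      ring_nf
    · simp [hx]

/-- The reflection exchanging `g` and `g'` preserves Lebesgue measure and the unit ball. With `β = q
+ d` the radial weight in the ball formula is trivial, and the common factor `1/β` cancels. -/
lemma sphereMoment_congr_norm [Nontrivial E] {g g' : E} (h : ‖g‖ = ‖g'‖) (q : ℝ) (hq : 0 < q) :
    sphereMoment g q = sphereMoment g' q := by
  have hd : (0 : ℝ) < Module.finrank ℝ E := by exact_mod_cast Module.finrank_pos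
  have hβ : 0 < q + Module.finrank ℝ E := by positivity
  have h1 := lintegral_ball_inner_rpow g q hβ one_pos
  have h2 := lintegral_ball_inner_rpow g' q hβ one_pos
  set T : E ≃ₗᵢ[ℝ] E := (ℝ ∙ (g - g'))ᗮ.reflection
  have hT : T g = g' := Submodule.reflection_sub h
  have h3 : ∫⁻ x in Metric.ball (0 : E) 1, ENNReal.ofReal (|inner ℝ g x| ^ q) *
        ENNReal.ofReal (‖x‖ ^ (q + Module.finrank ℝ E - q - Module.finrank ℝ E)) =
      ∫⁻ x in Metric.ball (0 : E) 1, ENNReal.ofReal (|inner ℝ g' x| ^ q) *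
        ENNReal.ofReal (‖x‖ ^ (q + Module.finrank ℝ E - q - Module.finrank ℝ E)) := by
    conv_rhs => rw [← (T.measurePreserving.restrict_preimage
      measurableSet_ball).lintegral_comp_emb T.toHomeomorph.measurableEmbedding]
    have : T ⁻¹' Metric.ball 0 1 = Metric.ball (0 : E) 1 := by
      ext x; simp
    rw [this]
    refine lintegral_congr fun x => ?_
    rw [← hT, T.inner_map_map, T.norm_map]
  rw [h1, h2] at h3
  exact (ENNReal.mul_left_inj (by simp; positivity) ENNReal.ofReal_ne_top).1 h3

lemma sphereMoment_smul (c : ℝ) (g : E) (q : ℝ) :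
    sphereMoment (c • g) q = ENNReal.ofReal (|c| ^ q) * sphereMoment g q := by
  simp only [sphereMoment]
  rw [← lintegral_const_mul _ (by fun_prop)]
  refine lintegral_congr fun ξ => ?_
  rw [← ENNReal.ofReal_mul (by positivity), ← Real.mul_rpow (by positivity) (by positivity),
    ← abs_mul, real_inner_smul_left]

lemma sphereMoment_eq_norm_rpow_mul [Nontrivial E] {e : E} (he : ‖e‖ = 1) (g : E) {q : ℝ}
    (hq : 0 < q) : sphereMoment g q = ENNReal.ofReal (‖g‖ ^ q) * sphereMoment e q := by
  rw [sphereMoment_congr_norm (g' := ‖g‖ • e) (by simp [norm_smul, he]) q hq, sphereMoment_smul,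
    abs_norm]

lemma sphereMoment_le (g : E) {q : ℝ} (hq : 0 ≤ q) :
    sphereMoment g q ≤ ENNReal.ofReal (‖g‖ ^ q) * (volume : Measure E).toSphere univ := by
  rw [← lintegral_const]
  refine lintegral_mono fun ξ => ENNReal.ofReal_le_ofReal ?_
  refine Real.rpow_le_rpow (abs_nonneg _) ?_ hq
  simpa using abs_real_inner_le_norm g (ξ : E)

lemma sphereMoment_ne_top (g : E) {q : ℝ} (hq : 0 ≤ q) : sphereMoment g q ≠ ⊤ :=
  ((sphereMoment_le g hq).trans_lt
    (ENNReal.mul_lt_top ENNReal.ofReal_lt_top (measure_lt_top _ _))).ne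

end Polar

/-! ### The constant `K_{n,q}` and its Gamma function formula -/

section Constant

variable {n : ℕ}

lemma integral_abs_rpow_mul_exp_neg_sq {q : ℝ} (hq : -1 < q) :
    ∫ t : ℝ, |t| ^ q * Real.exp (-t ^ 2) = Real.Gamma ((q + 1) / 2) := by
  have h := integral_comp_abs (f := fun t : ℝ => t ^ q * Real.exp (-t ^ 2))
  simp only [sq_abs] at h
  rw [h]
  have h2 := integral_rpow_mul_exp_neg_rpow (p := 2) two_pos hq
  simp only [Real.rpow_two] at h2
  rw [h2]
  ring

lemma integral_abs_coord_rpow_mul_exp (i : Fin n) {q : ℝ} (hq : -1 < q) :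
    ∫ x : EuclideanSpace ℝ (Fin n), |x i| ^ q * Real.exp (-‖x‖ ^ 2) =
      Real.Gamma ((q + 1) / 2) * Real.pi ^ (((n : ℝ) - 1) / 2) := by
  have hn : 0 < n := i.pos
  rw [← (PiLp.volume_preserving_toLp (Fin n)).integral_comp
    (MeasurableEquiv.toLp 2 (Fin n → ℝ)).measurableEmbedding]
  have h1 : ∀ x : Fin n → ℝ, |(WithLp.toLp 2 x) i| ^ q * Real.exp (-‖WithLp.toLp 2 x‖ ^ 2) =
      ∏ j, (if j = i then |x j| ^ q * Real.exp (-x j ^ 2) else Real.exp (-x j ^ 2)) := by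
    intro x
    rw [EuclideanSpace.real_norm_sq_eq, ← Finset.sum_neg_distrib, Real.exp_sum]
    rw [← Finset.mul_prod_erase _ _ (Finset.mem_univ i),
      ← Finset.mul_prod_erase _ _ (Finset.mem_univ i), if_pos rfl, mul_assoc]
    congr 2
    refine Finset.prod_congr rfl fun j hj => ?_
    rw [if_neg (Finset.ne_of_mem_erase hj)]
  simp_rw [h1]
  have h3 : ∫ t : ℝ, Real.exp (-t ^ 2) = Real.pi ^ ((1 : ℝ) / 2) := by
    simpa [Real.sqrt_eq_rpow] using integral_gaussian 1
  rw [integral_fintype_prod_volume_eq_prod (fun j (t : ℝ) =>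
    if j = i then |t| ^ q * Real.exp (-t ^ 2) else Real.exp (-t ^ 2)),
    ← Finset.mul_prod_erase _ _ (Finset.mem_univ i)]
  simp only [if_true]
  rw [integral_abs_rpow_mul_exp_neg_sq hq]
  congr 1
  rw [Finset.prod_congr rfl (g := fun _ => Real.pi ^ ((1 : ℝ) / 2))
    fun j hj => by simp only [if_neg (Finset.ne_of_mem_erase hj)]; exact h3]
  rw [Finset.prod_const, Finset.card_erase_of_mem (Finset.mem_univ i), Finset.card_univ,
    Fintype.card_fin, ← Real.rpow_natCast, ← Real.rpow_mul Real.pi_pos.le, Nat.cast_sub hn]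
  congr 1
  push_cast
  ring

/-- The Gaussian moment `∫ |x_i|^q exp(-|x|²)` is computed twice, as a product over coordinates and
in polar coordinates; the quotient of the two results is the moment. -/
lemma sphereMoment_single_toReal (i : Fin n) {q : ℝ} (hq : 0 < q) :
    (sphereMoment (EuclideanSpace.single i (1 : ℝ)) q).toReal =
      2 * Real.pi ^ (((n : ℝ) - 1) / 2) *
        (Real.Gamma ((q + 1) / 2) / Real.Gamma (((n : ℝ) + q) / 2)) := by
  have hn : 0 < n := i.pos
  have hn' : (0 : ℝ) < n := by exact_mod_cast hn
  have : Nonempty (Fin n) := ⟨i⟩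
  have h := lintegral_inner_rpow_mul_fun_norm (EuclideanSpace.single i (1 : ℝ)) q
    (f := fun r => ENNReal.ofReal (Real.exp (-r ^ 2))) (by fun_prop)
  have h1 := integral_abs_coord_rpow_mul_exp i (q := q) (by linarith)
  rw [integral_eq_lintegral_of_nonneg_ae (Eventually.of_forall fun x => by positivity)
    (by fun_prop)] at h1
  have h2 := integral_rpow_mul_exp_neg_rpow (p := 2) (q := q + n - 1) two_pos (by linarith)
  rw [integral_eq_lintegral_of_nonneg_ae (ae_restrict_of_forall_mem measurableSet_Ioi
    fun x hx => mul_nonneg (Real.rpow_nonneg (le_of_lt hx) _) (Real.exp_pos _).le)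
    (by fun_prop)] at h2
  have h3 := congrArg ENNReal.toReal h
  rw [ENNReal.toReal_mul] at h3
  have h4 : ∫⁻ x : EuclideanSpace ℝ (Fin n),
      ENNReal.ofReal (|inner ℝ (EuclideanSpace.single i (1 : ℝ)) x| ^ q) *
        ENNReal.ofReal (Real.exp (-‖x‖ ^ 2)) =
      ∫⁻ x : EuclideanSpace ℝ (Fin n), ENNReal.ofReal (|x i| ^ q * Real.exp (-‖x‖ ^ 2)) := by
    refine lintegral_congr fun x => ?_
    rw [ENNReal.ofReal_mul (by positivity), EuclideanSpace.inner_single_left]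
    simp
  have h5 : ∫⁻ r in Ioi (0 : ℝ), ENNReal.ofReal (r ^ (q + Module.finrank ℝ
        (EuclideanSpace ℝ (Fin n)) - 1)) * ENNReal.ofReal (Real.exp (-r ^ 2)) =
      ∫⁻ r in Ioi (0 : ℝ), ENNReal.ofReal (r ^ (q + n - 1) * Real.exp (-r ^ (2 : ℝ))) := by
    refine setLIntegral_congr_fun measurableSet_Ioi fun r hr => ?_
    simp only [finrank_euclideanSpace_fin, Real.rpow_two]
    rw [ENNReal.ofReal_mul (Real.rpow_nonneg (le_of_lt hr) _)]
  rw [h4, h5, h1, h2] at h3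
  have hG : Real.Gamma (((n : ℝ) + q) / 2) ≠ 0 := (Real.Gamma_pos_of_pos (by positivity)).ne'
  rw [show (q + n - 1 + 1) / 2 = ((n : ℝ) + q) / 2 by ring] at h3
  field_simp
  linarith

lemma bbmConst_eq_sphereMoment (hn : 0 < n) (q : ℝ) :
    bbmConst n hn q = 1 / q * (sphereMoment (EuclideanSpace.single
      (⟨n - 1, Nat.sub_one_lt_of_lt hn⟩ : Fin n) (1 : ℝ)) q).toReal := by
  rw [bbmConst, sphereMoment, integral_eq_lintegral_of_nonneg_ae
    (Eventually.of_forall fun x => by positivity) (Measurable.aestronglyMeasurable (by fun_prop))]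
  congr 3
  funext ξ
  rw [EuclideanSpace.inner_single_left]
  simp

lemma bbmConst_eq (hn : 0 < n) {q : ℝ} (hq : 0 < q) :
    bbmConst n hn q = 2 * Real.pi ^ (((n : ℝ) - 1) / 2) *
      (Real.Gamma ((q + 1) / 2) / Real.Gamma (((n : ℝ) + q) / 2)) * (1 / q) := by
  rw [bbmConst_eq_sphereMoment, sphereMoment_single_toReal _ hq]
  ring

lemma continuousAt_Gamma_of_pos {s : ℝ} (hs : 0 < s) : ContinuousAt Real.Gamma s :=
  (Real.differentiableAt_Gamma fun m => by
    have : (0 : ℝ) ≤ m := m.cast_nonneg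
    linarith).continuousAt

lemma continuousAt_bbmConst (hn : 0 < n) {q : ℝ} (hq : 0 < q) :
    ContinuousAt (bbmConst n hn) q := by
  have hn' : (0 : ℝ) < n := by exact_mod_cast hn
  have h1 : ContinuousAt (fun q : ℝ => Real.Gamma ((q + 1) / 2)) q :=
    ContinuousAt.comp (f := fun q : ℝ => (q + 1) / 2) (continuousAt_Gamma_of_pos (by positivity))
      (by fun_prop)
  have h2 : ContinuousAt (fun q : ℝ => Real.Gamma (((n : ℝ) + q) / 2)) q :=
    ContinuousAt.comp (f := fun q : ℝ => ((n : ℝ) + q) / 2)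
      (continuousAt_Gamma_of_pos (by positivity)) (by fun_prop)
  have h3 : ContinuousAt (fun q : ℝ => 1 / q) q := continuousAt_const.div continuousAt_id hq.ne'
  have h4 := (continuousAt_const (y := 2 * Real.pi ^ (((n : ℝ) - 1) / 2))).mul
    (h1.div h2 (Real.Gamma_pos_of_pos (by positivity)).ne') |>.mul h3
  refine h4.congr ?_
  filter_upwards [lt_mem_nhds hq] with r hr
  exact (bbmConst_eq hn hr).symm

lemma sphereMoment_eq_bbmConst (hn : 0 < n) (g : EuclideanSpace ℝ (Fin n)) {q : ℝ} (hq : 0 < q) :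
    sphereMoment g q = ENNReal.ofReal (q * bbmConst n hn q * ‖g‖ ^ q) := by
  have : Nonempty (Fin n) := ⟨⟨0, hn⟩⟩
  rw [sphereMoment_eq_norm_rpow_mul (e := EuclideanSpace.single
      (⟨n - 1, Nat.sub_one_lt_of_lt hn⟩ : Fin n) (1 : ℝ)) (by simp) g hq,
    bbmConst_eq_sphereMoment, mul_comm, ENNReal.ofReal_mul (by positivity), ← mul_assoc,
    mul_one_div_cancel hq.ne', one_mul, ENNReal.ofReal_toReal (sphereMoment_ne_top _ hq.le)]

end Constant

/-! ### Integrability and Fubini for averages along segments -/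

section Translation

variable {E : Type*} [NormedAddCommGroup E] [NormedSpace ℝ E] [FiniteDimensional ℝ E]
  [MeasurableSpace E] [BorelSpace E] {μ : Measure E}

lemma integrable_mul_comp_sub_smul [SFinite μ] {f : E → ℝ} (hf : LocallyIntegrable f μ) {ψ : E → ℝ}
    (hψ : Continuous ψ) (hψc : HasCompactSupport ψ) (h : E) :
    Integrable (fun z : E × ℝ => f z.1 * ψ (z.1 - z.2 • h))
      (μ.prod (volume.restrict (Ioc (0 : ℝ) 1))) := by
  obtain ⟨C, hC⟩ := hψc.exists_bound_of_continuous hψ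
  -- `K` is the set swept out by the support of `ψ` under the shifts `t • h` with `0 ≤ t ≤ 1`; it is
  -- compact, so `C * |f|` on `K` is an integrable majorant.
  set K : Set E := (fun z : E × ℝ => z.1 + z.2 • h) '' (tsupport ψ ×ˢ Icc (0 : ℝ) 1)
  have hK : IsCompact K := (hψc.prod isCompact_Icc).image (by fun_prop)
  have h1 : Integrable (fun z : E × ℝ => C * ‖K.indicator f z.1‖)
      (μ.prod (volume.restrict (Ioc (0 : ℝ) 1))) :=
    ((((integrable_indicator_iff hK.measurableSet).2
      (hf.integrableOn_isCompact hK)).comp_fst (volume.restrict (Ioc (0 : ℝ) 1))).norm).const_mul C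
  refine h1.mono' ?_ ?_
  · exact (hf.aestronglyMeasurable.comp_fst).mul
      (Continuous.aestronglyMeasurable (by fun_prop))
  · have : ∀ᵐ z ∂(μ.prod (volume.restrict (Ioc (0 : ℝ) 1))), z.2 ∈ Ioc (0 : ℝ) 1 :=
      Measure.quasiMeasurePreserving_snd.ae (ae_restrict_mem measurableSet_Ioc)
    filter_upwards [this] with z hz
    by_cases hzK : z.1 ∈ K
    · rw [indicator_of_mem hzK, norm_mul, mul_comm]
      gcongr
      exact hC _
    · have : ψ (z.1 - z.2 • h) = 0 := by
        by_contra hne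
        refine hzK ⟨(z.1 - z.2 • h, z.2), ⟨subset_tsupport _ hne, hz.1.le, hz.2⟩, ?_⟩
        simp
      simp [this, hzK]

variable [μ.IsAddHaarMeasure]

lemma integrable_comp_add_smul_mul {f : E → ℝ} (hfm : Measurable f) (hf : LocallyIntegrable f μ)
    {ψ : E → ℝ} (hψ : Continuous ψ) (hψc : HasCompactSupport ψ) (h : E) :
    Integrable (fun z : E × ℝ => f (z.1 + z.2 • h) * ψ z.1)
      (μ.prod (volume.restrict (Ioc (0 : ℝ) 1))) := by
  have h1 := integrable_mul_comp_sub_smul hf hψ hψc h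
  rw [integrable_prod_iff' h1.aestronglyMeasurable] at h1
  rw [integrable_prod_iff' (Measurable.aestronglyMeasurable (by fun_prop))]
  refine ⟨h1.1.mono fun t ht => ?_, h1.2.congr (Eventually.of_forall fun t => ?_)⟩
  · simpa using ht.comp_add_right (t • h)
  · simp only
    rw [← integral_add_right_eq_self (μ := μ) _ (t • h)]
    simp

lemma locallyIntegrable_integral_comp_add_smul {f : E → ℝ} (hfm : Measurable f)
    (hf : LocallyIntegrable f μ) (h : E) :
    LocallyIntegrable (fun x => ∫ t in Ioc (0 : ℝ) 1, f (x + t • h)) μ := by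
  rw [locallyIntegrable_iff]
  intro K hK
  obtain ⟨ψ, hψ1, -, hψc, -⟩ := exists_continuous_one_zero_of_isCompact hK isClosed_empty
    (disjoint_empty K)
  have h1 := (integrable_comp_add_smul_mul hfm hf ψ.continuous hψc h).integral_prod_left
  refine (h1.integrableOn (s := K)).congr_fun (fun x hx => ?_) hK.measurableSet
  simp [hψ1 hx]

lemma LocallyIntegrable.comp_add_right_haar {f : E → ℝ} (hf : LocallyIntegrable f μ) (h : E) :
    LocallyIntegrable (fun x => f (x + h)) μ := by
  rw [locallyIntegrable_iff] at hf ⊢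
  intro K hK
  have h1 := hf ((fun x => x + h) '' K) (hK.image (by fun_prop))
  have h2 := ((measurePreserving_add_right μ h).integrableOn_image
    (Homeomorph.addRight h).measurableEmbedding (f := f) (s := K)).1 h1
  exact h2

end Translation

/-! ### Fundamental theorem of calculus for weak gradients -/

section WeakGradient

variable {n : ℕ}

lemma HasWeakGradient.integral_mul_fderiv_eq {v : EuclideanSpace ℝ (Fin n) → ℝ}
    {H : EuclideanSpace ℝ (Fin n) → EuclideanSpace ℝ (Fin n)} (hv : HasWeakGradient univ v H)
    {φ : EuclideanSpace ℝ (Fin n) → ℝ} (hφ : ContDiff ℝ ∞ φ) (hφc : HasCompactSupport φ)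
    (h : EuclideanSpace ℝ (Fin n)) :
    ∫ x, v x * fderiv ℝ φ x h = - ∫ x, inner ℝ (H x) h * φ x := by
  have hv1 : LocallyIntegrable v volume := locallyIntegrableOn_univ.1 hv.locallyIntegrableOn
  have hH1 : LocallyIntegrable H volume := locallyIntegrableOn_univ.1 hv.locallyIntegrableOn_grad
  have hi := fun i => hv.integral_eq φ hφ hφc (subset_univ _) i
  simp only [Measure.restrict_univ] at hi
  have h1 : ∀ x, v x * fderiv ℝ φ x h =
      ∑ i, h i * (v x * fderiv ℝ φ x (EuclideanSpace.single i 1)) := by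
    intro x
    have : h = ∑ i, h i • EuclideanSpace.single i (1 : ℝ) := by
      ext j
      simp [Finset.sum_apply, Pi.single_apply]
    conv_lhs => rw [this, map_sum, Finset.mul_sum]
    refine Finset.sum_congr rfl fun i _ => ?_
    rw [map_smul, smul_eq_mul]
    ring
  have h2 : ∀ x, inner ℝ (H x) h * φ x = ∑ i, h i * (H x i * φ x) := by
    intro x
    rw [PiLp.inner_apply, Finset.sum_mul]
    refine Finset.sum_congr rfl fun i _ => ?_
    simp [mul_assoc]
  have hφ' : ∀ i, Continuous fun x => fderiv ℝ φ x (EuclideanSpace.single i (1 : ℝ)) := fun i =>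
    (hφ.continuous_fderiv (by simp)).clm_apply continuous_const
  have hφ'c : ∀ i, HasCompactSupport fun x => fderiv ℝ φ x (EuclideanSpace.single i (1 : ℝ)) :=
    fun i => hφc.fderiv_apply (𝕜 := ℝ) _
  have hHi : ∀ i, LocallyIntegrable (fun x => H x i) volume := by
    intro i
    rw [locallyIntegrable_iff] at hH1 ⊢
    intro K hK
    exact (EuclideanSpace.proj (𝕜 := ℝ) i).integrable_comp (hH1 K hK)
  simp_rw [h1, h2]
  rw [integral_finsetSum, integral_finsetSum, ← Finset.sum_neg_distrib]
  · refine Finset.sum_congr rfl fun i _ => ?_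
    rw [integral_const_mul, integral_const_mul, hi i]
    ring
  · intro i _
    refine Integrable.const_mul ?_ _
    simpa [mul_comm] using
      (hHi i).integrable_smul_left_of_hasCompactSupport hφ.continuous hφc
  · intro i _
    refine Integrable.const_mul ?_ _
    simpa [mul_comm] using
      hv1.integrable_smul_left_of_hasCompactSupport (hφ' i) (hφ'c i)

/-- The fundamental theorem of calculus along segments, for functions with a weak gradient. -/
lemma HasWeakGradient.ae_sub_eq_integral {v : EuclideanSpace ℝ (Fin n) → ℝ}
    {H : EuclideanSpace ℝ (Fin n) → EuclideanSpace ℝ (Fin n)} (hv : HasWeakGradient univ v H)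
    (hHm : Measurable H) (h : EuclideanSpace ℝ (Fin n)) :
    ∀ᵐ x, v (x + h) - v x = ∫ t in Ioc (0 : ℝ) 1, inner ℝ (H (x + t • h)) h := by
  have hv1 : LocallyIntegrable v volume := locallyIntegrableOn_univ.1 hv.locallyIntegrableOn
  have hH1 : LocallyIntegrable H volume := locallyIntegrableOn_univ.1 hv.locallyIntegrableOn_grad
  set F : EuclideanSpace ℝ (Fin n) → ℝ := fun x => inner ℝ (H x) h
  have hFm : Measurable F := by fun_prop
  have hF : LocallyIntegrable F volume := by
    rw [locallyIntegrable_iff] at hH1 ⊢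
    intro K hK
    exact (hH1 K hK).inner_const h
  have hw1 := locallyIntegrable_integral_comp_add_smul hFm hF h
  have hvh := LocallyIntegrable.comp_add_right_haar hv1 h
  have hw : LocallyIntegrable (fun x => v (x + h) - v x - ∫ t in Ioc (0 : ℝ) 1, F (x + t • h))
      volume := (hvh.sub hv1).sub hw1
  suffices hz : ∀ᵐ x, v (x + h) - v x - ∫ t in Ioc (0 : ℝ) 1, F (x + t • h) = 0 by
    filter_upwards [hz] with x hx
    exact sub_eq_zero.1 hx
  -- Tested against `φ`, the increment of `v` moves onto `φ`. The increment of `φ` is an integral of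
  -- derivatives along the segment; after Fubini, the weak gradient identity applies for each `t` to
  -- the translate of `φ` by `t • h`.
  refine ae_eq_zero_of_integral_contDiff_smul_eq_zero hw fun φ hφ hφc => ?_
  have i1 : Integrable (fun x => φ x * v (x + h)) volume :=
    hvh.integrable_smul_left_of_hasCompactSupport hφ.continuous hφc
  have i2 : Integrable (fun x => φ x * v x) volume :=
    hv1.integrable_smul_left_of_hasCompactSupport hφ.continuous hφc
  have i3 : Integrable (fun x => φ x * ∫ t in Ioc (0 : ℝ) 1, F (x + t • h)) volume :=
    hw1.integrable_smul_left_of_hasCompactSupport hφ.continuous hφc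
  have i4 : Integrable (fun x => φ (x - h) * v x) volume := by
    simpa using i1.comp_sub_right h
  have i5 : Integrable (fun x => φ x * v (x + h) - φ x * v x) volume := i1.sub i2
  simp only [smul_eq_mul, mul_sub]
  rw [integral_sub i5 i3, integral_sub i1 i2]
  have e1 : ∫ x, φ x * v (x + h) = ∫ x, φ (x - h) * v x := by
    rw [← integral_sub_right_eq_self _ h]
    simp
  have hφd : Continuous (fun x => fderiv ℝ φ x h) :=
    (hφ.continuous_fderiv (by simp)).clm_apply continuous_const
  have e2 : ∀ x, φ (x - h) - φ x = - ∫ t in Ioc (0 : ℝ) 1, fderiv ℝ φ (x - t • h) h := by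
    intro x
    have hd : ∀ t ∈ uIcc (0 : ℝ) 1, HasDerivAt (fun t : ℝ => φ (x - t • h))
        (-fderiv ℝ φ (x - t • h) h) t := by
      intro t _
      have h1 : HasDerivAt (fun t : ℝ => x - t • h) (-h) t := by
        simpa using ((hasDerivAt_id t).smul_const h).const_sub x
      have h2 := ((hφ.differentiable (by simp)) (x - t • h)).hasFDerivAt.comp_hasDerivAt t h1
      rw [map_neg] at h2
      exact h2
    have h3 := intervalIntegral.integral_eq_sub_of_hasDerivAt hd
      (Continuous.intervalIntegrable (by fun_prop) _ _)
    rw [intervalIntegral.integral_of_le zero_le_one, integral_neg] at h3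
    simpa using h3.symm
  have e3 : (∫ x, φ x * v (x + h)) - ∫ x, φ x * v x =
      - ∫ x, ∫ t in Ioc (0 : ℝ) 1, v x * fderiv ℝ φ (x - t • h) h := by
    rw [e1, ← integral_sub i4 i2, ← integral_neg]
    refine integral_congr_ae (Eventually.of_forall fun x => ?_)
    simp only
    rw [← sub_mul, e2, integral_const_mul]
    ring
  have e4 : ∀ t : ℝ, ∫ x, v x * fderiv ℝ φ (x - t • h) h = - ∫ x, F (x + t • h) * φ x := by
    intro t
    have h1 := hv.integral_mul_fderiv_eq (φ := fun x => φ (x - t • h)) (by fun_prop)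
      (hφc.comp_homeomorph (Homeomorph.subRight (t • h))) h
    simp only [fderiv_comp_sub] at h1
    rw [h1, ← integral_add_right_eq_self _ (t • h)]
    simp [F]
  have j1 := integrable_mul_comp_sub_smul hv1 hφd (hφc.fderiv_apply (𝕜 := ℝ) h) h
  have j2 := integrable_comp_add_smul_mul hFm hF hφ.continuous hφc h
  rw [e3, integral_integral_swap (f := fun x t => v x * fderiv ℝ φ (x - t • h) h) j1]
  simp_rw [e4]
  rw [integral_neg, neg_neg,
    ← integral_integral_swap (f := fun x t => F (x + t • h) * φ x) j2, sub_eq_zero]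
  refine integral_congr_ae (Eventually.of_forall fun x => ?_)
  simp only
  rw [integral_mul_const, mul_comm]

end WeakGradient

/-! ### Continuity of translations and Taylor expansion in `L^q` -/

section LpTranslation

lemma tendsto_lintegral_enorm_translate_sub {E F : Type*} [NormedAddCommGroup E]
    [NormedSpace ℝ E] [FiniteDimensional ℝ E] [MeasurableSpace E] [BorelSpace E]
    [NormedAddCommGroup F] {μ : Measure E} [μ.IsAddHaarMeasure] {q : ℝ} (hq : 1 ≤ q) {H : E → F}
    (hH : MemLp H (ENNReal.ofReal q) μ) :
    Tendsto (fun k : E => ∫⁻ x, ‖H (x + k) - H x‖ₑ ^ q ∂μ) (𝓝 0) (𝓝 0) := by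
  have hq0 : 0 < q := by linarith
  have : Fact (1 ≤ ENNReal.ofReal q) := ⟨by simpa using ENNReal.ofReal_le_ofReal hq⟩
  have : Fact (ENNReal.ofReal q ≠ ⊤) := ⟨ENNReal.ofReal_ne_top⟩
  have hc : Continuous fun k : E => edist (DomAddAct.mk k +ᵥ hH.toLp H) (hH.toLp H) := by
    have h1 : Continuous fun k : E => DomAddAct.mk k +ᵥ hH.toLp H :=
      DomAddAct.continuous_mk.vadd continuous_const
    exact h1.edist continuous_const
  have h0 := (hc.tendsto 0)
  have h00 : DomAddAct.mk (0 : E) +ᵥ hH.toLp H = hH.toLp H := by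
    rw [DomAddAct.mk_vadd_toLp]; simp
  simp only [h00, edist_self] at h0
  have h2 := ((ENNReal.continuous_rpow_const (y := q)).tendsto 0).comp h0
  rw [ENNReal.zero_rpow_of_pos hq0] at h2
  refine h2.congr fun k => ?_
  simp only [Function.comp_apply]
  rw [DomAddAct.mk_vadd_toLp, Lp.edist_toLp_toLp,
    eLpNorm_eq_lintegral_rpow_enorm_toReal (by simpa using hq0) (by simp),
    ENNReal.toReal_ofReal hq0.le, ← ENNReal.rpow_mul, one_div_mul_cancel hq0.ne', ENNReal.rpow_one]
  simp [add_comm]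

/-- Cauchy–Schwarz in the inner product and Jensen for the probability measure on `(0,1]`. -/
lemma enorm_integral_sub_rpow_le {E : Type*} [NormedAddCommGroup E] [InnerProductSpace ℝ E]
    [FiniteDimensional ℝ E] [MeasurableSpace E] [BorelSpace E] {q : ℝ} (hq : 1 ≤ q) {H : E → E}
    (hH : Measurable H) (x h : E) :
    ‖(∫ t in Ioc (0 : ℝ) 1, inner ℝ (H (x + t • h)) h) - inner ℝ (H x) h‖ₑ ^ q ≤
      ‖h‖ₑ ^ q * ∫⁻ t in Ioc (0 : ℝ) 1, ‖H (x + t • h) - H x‖ₑ ^ q := by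
  have hq0 : 0 < q := by linarith
  by_cases hh : h = 0
  · simp [hh, hq0]
  have hh0 : ‖h‖ₑ ^ q ≠ 0 := by simp [hh]
  set τ : Measure ℝ := volume.restrict (Ioc (0 : ℝ) 1)
  have : IsProbabilityMeasure τ := ⟨by simp [τ]⟩
  set f : ℝ → E := fun t => H (x + t • h) - H x
  have hf : Measurable f := by fun_prop
  -- An infinite right side is trivial. A finite one gives, through Jensen, the integrability of `f`
  -- that is needed to subtract under the Bochner integral.
  by_cases hfin : ∫⁻ t, ‖f t‖ₑ ^ q ∂τ = ⊤
  · rw [hfin, ENNReal.mul_top hh0]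
    exact le_top
  have hle := eLpNorm_le_eLpNorm_of_exponent_le (μ := τ) (f := f) (p := 1)
    (q := ENNReal.ofReal q) (by simpa using ENNReal.ofReal_le_ofReal hq) hf.aestronglyMeasurable
  rw [eLpNorm_one_eq_lintegral_enorm,
    eLpNorm_eq_lintegral_rpow_enorm_toReal (by simpa using hq0) (by simp),
    ENNReal.toReal_ofReal hq0.le] at hle
  have hle' : (∫⁻ t, ‖f t‖ₑ ∂τ) ^ q ≤ ∫⁻ t, ‖f t‖ₑ ^ q ∂τ := by
    have := ENNReal.rpow_le_rpow hle hq0.le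
    rwa [← ENNReal.rpow_mul, one_div_mul_cancel hq0.ne', ENNReal.rpow_one] at this
  have hfi : Integrable f τ := by
    refine ⟨hf.aestronglyMeasurable, lt_top_iff_ne_top.2 fun htop => hfin ?_⟩
    rw [htop, ENNReal.top_rpow_of_pos hq0] at hle'
    exact top_le_iff.1 hle'
  have hHi : Integrable (fun t => inner ℝ (H (x + t • h)) h) τ := by
    have := (hfi.add (integrable_const (H x))).inner_const (𝕜 := ℝ) h
    simpa [f] using this
  have e1 : (∫ t, inner ℝ (H (x + t • h)) h ∂τ) - inner ℝ (H x) h = ∫ t, inner ℝ (f t) h ∂τ := by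
    simp only [f, inner_sub_left]
    rw [integral_sub hHi (integrable_const _)]
    simp
  rw [e1]
  have e2 : ‖∫ t, inner ℝ (f t) h ∂τ‖ₑ ≤ ‖h‖ₑ * ∫⁻ t, ‖f t‖ₑ ∂τ := by
    rw [← lintegral_const_mul _ (by fun_prop)]
    refine (enorm_integral_le_lintegral_enorm _).trans (lintegral_mono fun t => ?_)
    rw [mul_comm]
    have := norm_inner_le_norm (𝕜 := ℝ) (f t) h
    simp only [← ofReal_norm, ← ENNReal.ofReal_mul (norm_nonneg _)]
    exact ENNReal.ofReal_le_ofReal this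
  calc _ ≤ (‖h‖ₑ * ∫⁻ t, ‖f t‖ₑ ∂τ) ^ q := ENNReal.rpow_le_rpow e2 hq0.le
    _ = ‖h‖ₑ ^ q * (∫⁻ t, ‖f t‖ₑ ∂τ) ^ q := ENNReal.mul_rpow_of_nonneg _ _ hq0.le
    _ ≤ _ := by gcongr

variable {n : ℕ}

/-- First order Taylor expansion of Sobolev functions in `L^q`. -/
lemma HasWeakGradient.exists_lintegral_enorm_le {v : EuclideanSpace ℝ (Fin n) → ℝ}
    {H : EuclideanSpace ℝ (Fin n) → EuclideanSpace ℝ (Fin n)} (hv : HasWeakGradient univ v H)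
    (hHm : Measurable H) {q : ℝ} (hq : 1 ≤ q) (hH : MemLp H (ENNReal.ofReal q) volume)
    {ε : ℝ≥0∞} (hε : 0 < ε) :
    ∃ δ > 0, ∀ h : EuclideanSpace ℝ (Fin n), ‖h‖ < δ →
      ∫⁻ x, ‖v (x + h) - v x - inner ℝ (H x) h‖ₑ ^ q ≤ ε * ‖h‖ₑ ^ q := by
  have h1 := (tendsto_lintegral_enorm_translate_sub hq hH).eventually_le_const hε
  obtain ⟨δ, hδ, hball⟩ := Metric.eventually_nhds_iff_ball.1 h1
  refine ⟨δ, hδ, fun h hh => ?_⟩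
  calc ∫⁻ x, ‖v (x + h) - v x - inner ℝ (H x) h‖ₑ ^ q
      = ∫⁻ x, ‖(∫ t in Ioc (0 : ℝ) 1, inner ℝ (H (x + t • h)) h) - inner ℝ (H x) h‖ₑ ^ q := by
        refine lintegral_congr_ae ?_
        filter_upwards [hv.ae_sub_eq_integral hHm h] with x hx
        rw [hx]
    _ ≤ ∫⁻ x, ‖h‖ₑ ^ q * ∫⁻ t in Ioc (0 : ℝ) 1, ‖H (x + t • h) - H x‖ₑ ^ q :=
        lintegral_mono fun x => enorm_integral_sub_rpow_le hq hHm x h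
    _ = ‖h‖ₑ ^ q * ∫⁻ t in Ioc (0 : ℝ) 1, ∫⁻ x, ‖H (x + t • h) - H x‖ₑ ^ q := by
        rw [lintegral_const_mul' _ _ (by simp [(by linarith : 0 ≤ q)]),
          lintegral_lintegral_swap (Measurable.aemeasurable (by unfold Function.uncurry; fun_prop))]
    _ ≤ ‖h‖ₑ ^ q * ∫⁻ t in Ioc (0 : ℝ) 1, ε := by
        gcongr ‖h‖ₑ ^ q * ?_
        refine setLIntegral_mono' measurableSet_Ioc fun t ht => hball _ ?_
        rw [mem_ball_zero_iff, norm_smul, Real.norm_of_nonneg ht.1.le]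
        exact (mul_le_of_le_one_left (norm_nonneg _) ht.2).trans_lt hh
    _ = ε * ‖h‖ₑ ^ q := by simp [mul_comm]

end LpTranslation

/-! ### Restriction and uniqueness of weak gradients -/

section Uniqueness

variable {n : ℕ}

lemma LocallyIntegrableOn.integrable_mul_of_tsupport_subset
    {Ω : Set (EuclideanSpace ℝ (Fin n))} {f φ : EuclideanSpace ℝ (Fin n) → ℝ}
    (hf : LocallyIntegrableOn f Ω volume) (hφ : Continuous φ) (hφc : HasCompactSupport φ)
    (hφΩ : tsupport φ ⊆ Ω) : Integrable (fun x => f x * φ x) volume := by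
  rw [← integrableOn_iff_integrable_of_support_subset (s := tsupport φ)]
  · exact (hf.integrableOn_compact_subset hφΩ hφc).mul_continuousOn hφ.continuousOn hφc
  · intro x hx
    exact subset_tsupport _ (right_ne_zero_of_mul hx)

lemma HasWeakGradient.congr {Ω : Set (EuclideanSpace ℝ (Fin n))}
    {u v : EuclideanSpace ℝ (Fin n) → ℝ}
    {G H : EuclideanSpace ℝ (Fin n) → EuclideanSpace ℝ (Fin n)}
    (hu : HasWeakGradient Ω u G) (huv : u =ᵐ[volume.restrict Ω] v)
    (hGH : G =ᵐ[volume.restrict Ω] H) : HasWeakGradient Ω v H where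
  locallyIntegrableOn := hu.locallyIntegrableOn.congr huv
  locallyIntegrableOn_grad := hu.locallyIntegrableOn_grad.congr hGH
  integral_eq φ hφ hφc hφΩ i := by
    have h := hu.integral_eq φ hφ hφc hφΩ i
    have e1 : ∫ x in Ω, v x * fderiv ℝ φ x (EuclideanSpace.single i 1) =
        ∫ x in Ω, u x * fderiv ℝ φ x (EuclideanSpace.single i 1) :=
      integral_congr_ae (huv.mono fun x hx => by simp only [hx])
    have e2 : ∫ x in Ω, H x i * φ x = ∫ x in Ω, G x i * φ x :=
      integral_congr_ae (hGH.mono fun x hx => by simp only [hx])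
    rw [e1, e2, h]

lemma HasWeakGradient.mono {Ω Ω' : Set (EuclideanSpace ℝ (Fin n))} (hΩ : Ω' ⊆ Ω)
    {u : EuclideanSpace ℝ (Fin n) → ℝ}
    {G : EuclideanSpace ℝ (Fin n) → EuclideanSpace ℝ (Fin n)}
    (hu : HasWeakGradient Ω u G) : HasWeakGradient Ω' u G where
  locallyIntegrableOn := hu.locallyIntegrableOn.mono_set hΩ
  locallyIntegrableOn_grad := hu.locallyIntegrableOn_grad.mono_set hΩ
  integral_eq φ hφ hφc hφΩ i := by
    have h0 : ∀ x, x ∉ Ω' → φ x = 0 := fun x hx =>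
      image_eq_zero_of_notMem_tsupport fun hx' => hx (hφΩ hx')
    have h1 : ∀ x, x ∉ Ω' → fderiv ℝ φ x = 0 := fun x hx =>
      fderiv_of_notMem_tsupport ℝ fun hx' => hx (hφΩ hx')
    have h := hu.integral_eq φ hφ hφc (hφΩ.trans hΩ) i
    rw [setIntegral_eq_integral_of_forall_compl_eq_zero (fun x hx => by
        simp [h1 x fun h => hx (hΩ h)]),
      setIntegral_eq_integral_of_forall_compl_eq_zero (fun x hx => by
        simp [h0 x fun h => hx (hΩ h)])] at h
    rwa [setIntegral_eq_integral_of_forall_compl_eq_zero (fun x hx => by simp [h1 x hx]),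
      setIntegral_eq_integral_of_forall_compl_eq_zero (fun x hx => by simp [h0 x hx])]

lemma HasWeakGradient.ae_eq {Ω : Set (EuclideanSpace ℝ (Fin n))} (hΩ : IsOpen Ω)
    {u : EuclideanSpace ℝ (Fin n) → ℝ}
    {G H : EuclideanSpace ℝ (Fin n) → EuclideanSpace ℝ (Fin n)}
    (hG : HasWeakGradient Ω u G) (hH : HasWeakGradient Ω u H) :
    G =ᵐ[volume.restrict Ω] H := by
  have hcoord : ∀ {K : EuclideanSpace ℝ (Fin n) → EuclideanSpace ℝ (Fin n)} (i : Fin n),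
      LocallyIntegrableOn K Ω volume → LocallyIntegrableOn (fun x => K x i) Ω volume := by
    intro K i hK x hx
    obtain ⟨s, hs, hKs⟩ := hK x hx
    exact ⟨s, hs, (EuclideanSpace.proj (𝕜 := ℝ) i).integrable_comp hKs⟩
  have hi : ∀ i, ∀ᵐ x, x ∈ Ω → G x i - H x i = 0 := by
    intro i
    have hGi := hcoord i hG.locallyIntegrableOn_grad
    have hHi := hcoord i hH.locallyIntegrableOn_grad
    refine hΩ.ae_eq_zero_of_integral_contDiff_smul_eq_zero (hGi.sub hHi) fun φ hφ hφc hφΩ => ?_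
    have h0 : ∀ x, x ∉ Ω → φ x = 0 := fun x hx =>
      image_eq_zero_of_notMem_tsupport fun hx' => hx (hφΩ hx')
    have e := neg_injective ((hG.integral_eq φ hφ hφc hφΩ i).symm.trans
      (hH.integral_eq φ hφ hφc hφΩ i))
    rw [setIntegral_eq_integral_of_forall_compl_eq_zero (fun x hx => by simp [h0 x hx]),
      setIntegral_eq_integral_of_forall_compl_eq_zero (fun x hx => by simp [h0 x hx])] at e
    have iG := LocallyIntegrableOn.integrable_mul_of_tsupport_subset hGi hφ.continuous hφc hφΩ
    have iH := LocallyIntegrableOn.integrable_mul_of_tsupport_subset hHi hφ.continuous hφc hφΩ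
    simp only [smul_eq_mul, mul_comm (φ _), sub_mul]
    rw [integral_sub iG iH, e, sub_self]
  rw [Filter.EventuallyEq, ae_restrict_iff' hΩ.measurableSet]
  filter_upwards [ae_all_iff.2 hi] with x hx hxΩ
  ext i
  exact sub_eq_zero.1 (hx i hxΩ)

end Uniqueness

/-! ### Elementary inequalities for powers -/

section RealInequalities

/-- Trades a variable exponent for two constant ones, for which `L^q` estimates are available. -/
lemma rpow_le_rpow_add_rpow {a b p t : ℝ} (hap : a ≤ p) (hpb : p ≤ b) (ha : 0 < a) (ht : 0 ≤ t) :
    t ^ p ≤ t ^ a + t ^ b := by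
  rcases ht.eq_or_lt with rfl | ht
  · rw [Real.zero_rpow (by linarith), Real.zero_rpow (by linarith), Real.zero_rpow (by linarith)]
    simp
  rcases le_total t 1 with h | h
  · linarith [Real.rpow_le_rpow_of_exponent_ge ht h hap, Real.rpow_nonneg ht.le b]
  · linarith [Real.rpow_le_rpow_of_exponent_le h hpb, Real.rpow_nonneg ht.le a]

/-- `B + C` is the convex combination of `B/(1-l)` and `C/l` with weights `1-l` and `l`, hence at
most the larger of the two. The point is that the constant in front of `B^p` tends to `1` as `l`
tends to `0`, uniformly in `p ≤ b`. -/
lemma add_rpow_le_of_mem_Ioo {l b p B C : ℝ} (hl : l ∈ Ioo (0 : ℝ) 1) (hp : 0 ≤ p) (hpb : p ≤ b)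
    (hB : 0 ≤ B) (hC : 0 ≤ C) :
    (B + C) ^ p ≤ (1 - l) ^ (-b) * B ^ p + l ^ (-b) * C ^ p := by
  have key : ∀ {c X : ℝ}, c ∈ Ioo (0 : ℝ) 1 → 0 ≤ X → (X / c) ^ p ≤ c ^ (-b) * X ^ p := by
    intro c X hc hX
    rw [div_eq_mul_inv, Real.mul_rpow hX (inv_nonneg.2 hc.1.le), mul_comm,
      Real.inv_rpow hc.1.le, ← Real.rpow_neg hc.1.le]
    gcongr ?_ * _
    exact Real.rpow_le_rpow_of_exponent_ge hc.1 hc.2.le (by linarith)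
  have hl' : 1 - l ∈ Ioo (0 : ℝ) 1 := ⟨by linarith [hl.2], by linarith [hl.1]⟩
  have h1 := key hl' hB
  have h2 := key hl hC
  have h3 : 0 ≤ (B / (1 - l)) ^ p := Real.rpow_nonneg (div_nonneg hB hl'.1.le) _
  have h4 : 0 ≤ (C / l) ^ p := Real.rpow_nonneg (div_nonneg hC hl.1.le) _
  rcases le_total (B / (1 - l)) (C / l) with h | h
  · have : B + C ≤ C / l := by
      rw [div_le_iff₀ hl'.1] at h
      have e : C = C / l * l := (div_mul_cancel₀ C hl.1.ne').symm
      nlinarith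
    linarith [Real.rpow_le_rpow (by positivity) this hp]
  · have : B + C ≤ B / (1 - l) := by
      rw [div_le_iff₀ hl.1] at h
      have e : B = B / (1 - l) * (1 - l) := (div_mul_cancel₀ B hl'.1.ne').symm
      nlinarith
    linarith [Real.rpow_le_rpow (by positivity) this hp]

lemma rpow_le_mul_rpow_of_le {t M p q η : ℝ} (ht : 0 ≤ t) (htM : t ≤ M) (hM : 1 ≤ M) (hq : 0 < q)
    (hqp : q ≤ p) (hpq : p ≤ q + 2 * η) : t ^ p ≤ M ^ (2 * η) * t ^ q := by
  rcases ht.eq_or_lt with rfl | ht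
  · rw [Real.zero_rpow (by linarith), Real.zero_rpow (by linarith), mul_zero]
  have : t ^ p = t ^ (p - q) * t ^ q := by rw [← Real.rpow_add ht]; ring_nf
  rw [this]
  gcongr ?_ * _
  exact (Real.rpow_le_rpow ht.le htM (by linarith)).trans
    (Real.rpow_le_rpow_of_exponent_le hM (by linarith))

end RealInequalities

/-! ### Difference quotients, gradient quotients and the near kernel -/

section Quotients

open scoped Classical

variable {E : Type*} [NormedAddCommGroup E] [InnerProductSpace ℝ E]

/-- The absolute value of the difference quotient. -/
def diffQuotient (U : E → ℝ) (x y : E) : ℝ :=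
  |U x - U y| / ‖x - y‖

/-- The absolute value of the derivative `G x` in the direction of `y - x`. -/
def gradQuotient (G : E → E) (x y : E) : ℝ :=
  |inner ℝ (G x) (y - x)| / ‖x - y‖

/-- The error in the first order Taylor expansion, divided by the increment. -/
def taylorError (U : E → ℝ) (G : E → E) (x y : E) : ℝ :=
  |U y - U x - inner ℝ (G x) (y - x)| / ‖x - y‖

lemma taylorError_nonneg (U : E → ℝ) (G : E → E) (x y : E) : 0 ≤ taylorError U G x y :=
  div_nonneg (abs_nonneg _) (norm_nonneg _)

lemma diffQuotient_nonneg {E : Type*} [NormedAddCommGroup E] (U : E → ℝ) (x y : E) : 0 ≤ diffQuotient U x y :=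
  div_nonneg (abs_nonneg _) (norm_nonneg _)

lemma gradQuotient_nonneg (G : E → E) (x y : E) : 0 ≤ gradQuotient G x y :=
  div_nonneg (abs_nonneg _) (norm_nonneg _)

lemma gradQuotient_le (G : E → E) (x y : E) : gradQuotient G x y ≤ ‖G x‖ := by
  refine div_le_of_le_mul₀ (norm_nonneg _) (norm_nonneg _) ?_
  rw [norm_sub_rev]
  exact abs_real_inner_le_norm _ _

lemma diffQuotient_le_add (U : E → ℝ) (G : E → E) (x y : E) :
    diffQuotient U x y ≤ gradQuotient G x y + taylorError U G x y := by
  unfold diffQuotient gradQuotient taylorError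
  rw [← add_div, abs_sub_comm (U x)]
  gcongr
  calc |U y - U x| = |inner ℝ (G x) (y - x) + (U y - U x - inner ℝ (G x) (y - x))| := by ring_nf
    _ ≤ _ := abs_add_le _ _

lemma gradQuotient_le_add (U : E → ℝ) (G : E → E) (x y : E) :
    gradQuotient G x y ≤ diffQuotient U x y + taylorError U G x y := by
  unfold diffQuotient gradQuotient taylorError
  rw [← add_div, abs_sub_comm (U x)]
  gcongr
  calc |inner ℝ (G x) (y - x)| = |(U y - U x) - (U y - U x - inner ℝ (G x) (y - x))| := by ring_nf
    _ ≤ _ := abs_sub _ _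

/-- The kernel `A ^ p ‖x - y‖ ^ ((1 - s) p - d)`, cut off at distance `δ`. -/
def nearKernel (P : E → E → ℝ) (s δ : ℝ) (A : E → E → ℝ) (x y : E) : ℝ≥0∞ :=
  if x ≠ y ∧ ‖x - y‖ < δ then
    ENNReal.ofReal (A x y ^ P x y * ‖x - y‖ ^ ((1 - s) * P x y - Module.finrank ℝ E)) else 0

/-- At distances below `δ ≤ 1`, lowering `(1-s)P` to `(1-s)a` only increases the kernel. -/
lemma nearKernel_le {P A : E → E → ℝ} {a b s δ : ℝ} (ha : 0 < a) (hPa : ∀ x y, a ≤ P x y)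
    (hPb : ∀ x y, P x y ≤ b) (hs : s < 1) (hδ : δ ≤ 1) (hA0 : ∀ x y, 0 ≤ A x y) (x y : E) :
    nearKernel P s δ A x y ≤ if x ≠ y ∧ ‖x - y‖ < δ then
      (‖A x y‖ₑ ^ a + ‖A x y‖ₑ ^ b) *
        ENNReal.ofReal (‖x - y‖ ^ ((1 - s) * a - Module.finrank ℝ E)) else 0 := by
  have hb : 0 < b := ha.trans_le ((hPa x y).trans (hPb x y))
  unfold nearKernel
  split_ifs with h
  · have hxy : 0 < ‖x - y‖ := norm_pos_iff.2 (sub_ne_zero.2 h.1)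
    rw [Real.enorm_of_nonneg (hA0 x y), ENNReal.ofReal_rpow_of_nonneg (hA0 x y) ha.le,
      ENNReal.ofReal_rpow_of_nonneg (hA0 x y) hb.le, ← ENNReal.ofReal_add
        (Real.rpow_nonneg (hA0 x y) _) (Real.rpow_nonneg (hA0 x y) _),
      ← ENNReal.ofReal_mul (add_nonneg (Real.rpow_nonneg (hA0 x y) _)
        (Real.rpow_nonneg (hA0 x y) _))]
    refine ENNReal.ofReal_le_ofReal ?_
    have h1 := rpow_le_rpow_add_rpow (hPa x y) (hPb x y) ha (hA0 x y)
    have h2 : ‖x - y‖ ^ ((1 - s) * P x y - Module.finrank ℝ E) ≤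
        ‖x - y‖ ^ ((1 - s) * a - Module.finrank ℝ E) := by
      refine Real.rpow_le_rpow_of_exponent_ge hxy (h.2.le.trans hδ) ?_
      have := mul_le_mul_of_nonneg_left (hPa x y) (by linarith : 0 ≤ 1 - s)
      linarith
    have h3 := Real.rpow_nonneg (hA0 x y) (P x y)
    exact mul_le_mul h1 h2 (Real.rpow_nonneg hxy.le _) (h3.trans h1)
  · exact le_rfl

end Quotients

/-! ### The near modular: quasi-triangle inequality and Taylor error -/

section NearModular

open scoped Classical

variable {E : Type*} [NormedAddCommGroup E] [InnerProductSpace ℝ E] [FiniteDimensional ℝ E]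
  [MeasurableSpace E] [BorelSpace E]

/-- The modular of `A` with respect to the cut off kernel. -/
def nearModular (Ω : Set E) (P : E → E → ℝ) (s δ : ℝ) (A : E → E → ℝ) : ℝ≥0∞ :=
  ENNReal.ofReal (1 - s) * ∫⁻ x in Ω, ∫⁻ y in Ω, nearKernel P s δ A x y

lemma measurableSet_ne_and_norm_sub_lt (δ : ℝ) :
    MeasurableSet {z : E × E | z.1 ≠ z.2 ∧ ‖z.1 - z.2‖ < δ} :=
  (measurableSet_eq_fun measurable_fst measurable_snd).compl.inter
    (measurableSet_lt (f := fun z : E × E => ‖z.1 - z.2‖) (by fun_prop) measurable_const)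

lemma measurable_nearKernel {P A : E → E → ℝ} (hP : Measurable (Function.uncurry P))
    (hA : Measurable (Function.uncurry A)) (s δ : ℝ) :
    Measurable (Function.uncurry (nearKernel P s δ A)) := by
  have hP' : Measurable fun z : E × E => P z.1 z.2 := hP
  have hA' : Measurable fun z : E × E => A z.1 z.2 := hA
  have h : Measurable fun z : E × E => ENNReal.ofReal (A z.1 z.2 ^ P z.1 z.2 *
      ‖z.1 - z.2‖ ^ ((1 - s) * P z.1 z.2 - Module.finrank ℝ E)) := by fun_prop
  exact Measurable.ite (measurableSet_ne_and_norm_sub_lt δ) h measurable_const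

lemma nearModular_le_of_le_add {Ω : Set E} {P A B C : E → E → ℝ} {b s δ l : ℝ}
    (hP : Measurable (Function.uncurry P)) (hB : Measurable (Function.uncurry B))
    (hP0 : ∀ x y, 0 ≤ P x y) (hPb : ∀ x y, P x y ≤ b) (hl : l ∈ Ioo (0 : ℝ) 1)
    (hA0 : ∀ x y, 0 ≤ A x y) (hB0 : ∀ x y, 0 ≤ B x y) (hC0 : ∀ x y, 0 ≤ C x y)
    (hABC : ∀ x y, A x y ≤ B x y + C x y) :
    nearModular Ω P s δ A ≤ ENNReal.ofReal ((1 - l) ^ (-b)) * nearModular Ω P s δ B +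
      ENNReal.ofReal (l ^ (-b)) * nearModular Ω P s δ C := by
  have hl1 : 0 ≤ (1 - l) ^ (-b) := Real.rpow_nonneg (by linarith [hl.2]) _
  have hl0 : 0 ≤ l ^ (-b) := Real.rpow_nonneg hl.1.le _
  have hpt : ∀ x y, nearKernel P s δ A x y ≤
      ENNReal.ofReal ((1 - l) ^ (-b)) * nearKernel P s δ B x y +
      ENNReal.ofReal (l ^ (-b)) * nearKernel P s δ C x y := by
    intro x y
    unfold nearKernel
    split_ifs with h
    · have hB1 := Real.rpow_nonneg (hB0 x y) (P x y)
      have hC1 := Real.rpow_nonneg (hC0 x y) (P x y)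
      rw [← ENNReal.ofReal_mul hl1, ← ENNReal.ofReal_mul hl0,
        ← ENNReal.ofReal_add (by positivity) (by positivity), ← mul_assoc, ← mul_assoc, ← add_mul]
      refine ENNReal.ofReal_le_ofReal ?_
      gcongr ?_ * _
      exact (Real.rpow_le_rpow (hA0 x y) (hABC x y) (hP0 x y)).trans
        (add_rpow_le_of_mem_Ioo hl (hP0 x y) (hPb x y) (hB0 x y) (hC0 x y))
    · simp
  have hBm := measurable_nearKernel hP hB s δ
  unfold nearModular
  calc _ ≤ ENNReal.ofReal (1 - s) * ∫⁻ x in Ω, ∫⁻ y in Ω,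
          (ENNReal.ofReal ((1 - l) ^ (-b)) * nearKernel P s δ B x y +
            ENNReal.ofReal (l ^ (-b)) * nearKernel P s δ C x y) := by
        gcongr with x y
        exact hpt x y
    _ = _ := by
        have hBm1 : ∀ x, Measurable (nearKernel P s δ B x) := fun x => hBm.of_uncurry_left
        have hBm2 : Measurable fun x => ∫⁻ y in Ω, nearKernel P s δ B x y :=
          hBm.lintegral_prod_right'
        simp_rw [lintegral_add_left ((hBm1 _).const_mul _), lintegral_const_mul' _ _
          ENNReal.ofReal_ne_top]
        rw [lintegral_add_left (hBm2.const_mul _), lintegral_const_mul' _ _ ENNReal.ofReal_ne_top,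
          lintegral_const_mul' _ _ ENNReal.ofReal_ne_top]
        ring

/-- The radial integral is `1/((1-s)a)`, so the factor `1-s` cancels exactly and nothing depends on
`s`. -/
lemma ofReal_mul_lintegral_ball_norm_rpow [Nontrivial E] {a s : ℝ} (ha : 0 < a) (hs : s < 1) :
    ENNReal.ofReal (1 - s) * ∫⁻ h in Metric.ball (0 : E) 1,
        ENNReal.ofReal (‖h‖ ^ ((1 - s) * a - Module.finrank ℝ E)) =
      (volume : Measure E).toSphere univ * ENNReal.ofReal (1 / a) := by
  have hs' : 0 < 1 - s := by linarith
  -- With `g = 0` and `q = 0` the angular factor is `0 ^ 0 = 1`, so the moment is the total surface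
  -- measure.
  have h := lintegral_ball_inner_rpow (0 : E) 0 (mul_pos hs' ha) one_pos
  have h0 : sphereMoment (0 : E) 0 = (volume : Measure E).toSphere univ := by simp [sphereMoment]
  rw [h0] at h
  simp only [Real.rpow_zero, ENNReal.ofReal_one, one_mul, sub_zero, Real.one_rpow] at h
  rw [h, mul_left_comm, ← ENNReal.ofReal_mul hs'.le]
  congr 2
  field_simp

lemma lintegral_lintegral_comp_add {f : E → E → ℝ≥0∞} (hf : Measurable (Function.uncurry f)) :
    ∫⁻ x, ∫⁻ y, f x y = ∫⁻ h, ∫⁻ x, f x (x + h) := by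
  have hf' : Measurable fun z : E × E => f z.1 z.2 := hf
  rw [lintegral_lintegral_swap (f := fun h x => f x (x + h))]
  · exact lintegral_congr fun x => (lintegral_add_left_eq_self (f x) x).symm
  · exact (hf'.comp (measurable_snd.prodMk (measurable_snd.add measurable_fst))).aemeasurable

lemma measurable_diffQuotient {U : E → ℝ} (hU : Measurable U) :
    Measurable (Function.uncurry (diffQuotient U)) := by
  unfold diffQuotient Function.uncurry
  fun_prop

lemma measurable_gradQuotient {G : E → E} (hG : Measurable G) :
    Measurable (Function.uncurry (gradQuotient G)) := by
  unfold gradQuotient Function.uncurry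
  fun_prop

lemma measurable_taylorError {U : E → ℝ} {G : E → E} (hU : Measurable U) (hG : Measurable G) :
    Measurable (Function.uncurry (taylorError U G)) := by
  unfold taylorError Function.uncurry
  fun_prop

/-- Substitute `y = x + h` and integrate in `x` first: for fixed `h` the exponents `a` and `b`
contribute at most `ε` each, whence `2 * ε`. The remaining weight in `h` integrates to a constant
free of `s`. -/
lemma nearModular_taylorError_le [Nontrivial E] {Ω : Set E} (hΩ : MeasurableSet Ω) {U : E → ℝ}
    {G : E → E} {P : E → E → ℝ} {a b s δ : ℝ} {ε : ℝ≥0∞} (hU : Measurable U) (hG : Measurable G)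
    (ha : 0 < a) (hb : 0 < b) (hPa : ∀ x y, a ≤ P x y) (hPb : ∀ x y, P x y ≤ b)
    (hs : s < 1) (hδ : δ ≤ 1)
    (h : ∀ q ∈ ({a, b} : Set ℝ), ∀ h : E, ‖h‖ < δ →
      ∫⁻ x in Ω ∩ {x | x + h ∈ Ω}, ‖U (x + h) - U x - inner ℝ (G x) h‖ₑ ^ q ≤ ε * ‖h‖ₑ ^ q) :
    nearModular Ω P s δ (taylorError U G) ≤
      2 * ε * ((volume : Measure E).toSphere univ * ENNReal.ofReal (1 / a)) := by
  set T := taylorError U G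
  have hT : Measurable fun z : E × E => T z.1 z.2 := measurable_taylorError hU hG
  set w : E → ℝ≥0∞ := fun h => ENNReal.ofReal (‖h‖ ^ ((1 - s) * a - Module.finrank ℝ E))
  -- The constraints on `x` and `y` are absorbed into `f`, so that the substitution can be made on
  -- the whole space.
  set f : E → E → ℝ≥0∞ := fun x y => if x ∈ Ω ∧ y ∈ Ω ∧ (x ≠ y ∧ ‖x - y‖ < δ) then
    (‖T x y‖ₑ ^ a + ‖T x y‖ₑ ^ b) * w (x - y) else 0
  have hf : Measurable (Function.uncurry f) := by
    have hS : MeasurableSet {z : E × E | z.1 ∈ Ω ∧ z.2 ∈ Ω ∧ (z.1 ≠ z.2 ∧ ‖z.1 - z.2‖ < δ)} :=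
      (measurable_fst hΩ).inter ((measurable_snd hΩ).inter (measurableSet_ne_and_norm_sub_lt δ))
    exact Measurable.ite hS (by fun_prop) measurable_const
  have hq : ∀ q ∈ ({a, b} : Set ℝ), 0 < q := by
    rintro q (rfl | rfl) <;> assumption
  have hTq : ∀ q ∈ ({a, b} : Set ℝ), ∀ h : E, h ≠ 0 → ‖h‖ < δ →
      ∫⁻ x in Ω ∩ {x | x + h ∈ Ω}, ‖T x (x + h)‖ₑ ^ q ≤ ε := by
    intro q hqq k hk hkδ
    have hk0 : ‖k‖ₑ ^ q ≠ 0 := by simp [hk]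
    have hk1 : ‖k‖ₑ ^ q ≠ ⊤ := by simp [(hq q hqq).le]
    have e : ∀ x, ‖T x (x + k)‖ₑ ^ q =
        (‖k‖ₑ ^ q)⁻¹ * ‖U (x + k) - U x - inner ℝ (G x) k‖ₑ ^ q := by
      intro x
      have : T x (x + k) = ‖k‖⁻¹ * |U (x + k) - U x - inner ℝ (G x) k| := by
        simp [T, taylorError, div_eq_inv_mul]
      rw [this, enorm_mul, ENNReal.mul_rpow_of_nonneg _ _ (hq q hqq).le, enorm_inv (by simpa),
        enorm_norm, ENNReal.inv_rpow, Real.enorm_abs]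
    simp_rw [e]
    rw [lintegral_const_mul' _ _ (ENNReal.inv_ne_top.2 hk0)]
    calc _ ≤ (‖k‖ₑ ^ q)⁻¹ * (ε * ‖k‖ₑ ^ q) := by gcongr; exact h q hqq k hkδ
      _ = ε := by rw [mul_comm ε, ← mul_assoc, ENNReal.inv_mul_cancel hk0 hk1, one_mul]
  calc nearModular Ω P s δ T
      ≤ ENNReal.ofReal (1 - s) * ∫⁻ x, ∫⁻ y, f x y := by
        unfold nearModular
        rw [← lintegral_indicator hΩ]
        gcongr with x
        by_cases hx : x ∈ Ω
        · rw [indicator_of_mem hx, ← lintegral_indicator hΩ]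
          gcongr with y
          by_cases hy : y ∈ Ω
          · rw [indicator_of_mem hy]
            refine (nearKernel_le ha hPa hPb hs hδ (taylorError_nonneg U G) x y).trans_eq ?_
            simp [f, hx, hy, w, T]
          · simp [hy]
        · simp [hx]
    _ = ENNReal.ofReal (1 - s) * ∫⁻ h, ∫⁻ x, f x (x + h) := by
        rw [lintegral_lintegral_comp_add hf]
    _ ≤ ENNReal.ofReal (1 - s) * ∫⁻ h in Metric.ball (0 : E) 1, 2 * ε * w h := by
        rw [← lintegral_indicator measurableSet_ball]
        gcongr with k
        by_cases hk : k ≠ 0 ∧ ‖k‖ < δ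
        · rw [indicator_of_mem (by simpa using hk.2.trans_le hδ)]
          have hS : MeasurableSet (Ω ∩ {x | x + k ∈ Ω}) :=
            hΩ.inter ((measurable_id.add_const k) hΩ)
          have e : ∀ x, f x (x + k) = (Ω ∩ {x | x + k ∈ Ω}).indicator
              (fun x => w k * (‖T x (x + k)‖ₑ ^ a + ‖T x (x + k)‖ₑ ^ b)) x := by
            intro x
            by_cases hx : x ∈ Ω ∩ {x | x + k ∈ Ω}
            · rw [indicator_of_mem hx]
              have h1 : x ∈ Ω := hx.1
              have h2 : x + k ∈ Ω := hx.2
              simp [f, h1, h2, hk, w, mul_comm]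
            · rw [indicator_of_notMem hx]
              simp only [f]
              rw [if_neg]
              exact fun h => hx ⟨h.1, h.2.1⟩
          simp_rw [e]
          rw [lintegral_indicator hS, lintegral_const_mul' _ _ ENNReal.ofReal_ne_top,
            lintegral_add_left (by fun_prop), mul_comm, two_mul]
          gcongr
          · exact hTq a (by simp) k hk.1 hk.2
          · exact hTq b (by simp) k hk.1 hk.2
        · have : ∀ x, f x (x + k) = 0 := by
            intro x
            simp only [f]
            rw [if_neg]
            rintro ⟨-, -, h1, h2⟩
            exact hk ⟨by simpa using h1, by simpa using h2⟩
          simp [this]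
    _ = _ := by
        rw [lintegral_const_mul _ (by fun_prop), mul_left_comm,
          ofReal_mul_lintegral_ball_norm_rpow ha hs]

end NearModular

/-! ### Pointwise limit of the gradient quotient integrals -/

section PointwiseLimit

open scoped Classical

/-- Lowering the exponent by at most `2 * η` costs only `M ^ (2 * η)`, which tends to `1` with `η`;
the power of `r ≤ 1` moves in the favourable direction. -/
lemma rpow_mul_rpow_le {A M r s p q η d : ℝ} (hA : 0 ≤ A) (hAM : A ≤ M) (hM : 1 ≤ M) (hr : 0 < r)
    (hr1 : r ≤ 1) (hs : s < 1) (hq : 0 < q) (hqp : q ≤ p) (hpq : p ≤ q + 2 * η) :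
    A ^ p * r ^ ((1 - s) * p - d) ≤ M ^ (2 * η) * (A ^ q * r ^ ((1 - s) * q - d)) := by
  rw [← mul_assoc]
  have h1 := rpow_le_mul_rpow_of_le hA hAM hM hq hqp hpq
  have h2 : r ^ ((1 - s) * p - d) ≤ r ^ ((1 - s) * q - d) := by
    refine Real.rpow_le_rpow_of_exponent_ge hr hr1 ?_
    have := mul_le_mul_of_nonneg_left hqp (by linarith : 0 ≤ 1 - s)
    linarith
  exact mul_le_mul h1 h2 (Real.rpow_nonneg hr.le _) ((Real.rpow_nonneg hA _).trans h1)

section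

variable {E : Type*} [NormedAddCommGroup E] [InnerProductSpace ℝ E]
  {P : E → E → ℝ} {G : E → E} {x : E} {a b δ η ρ p₀ s M : ℝ}

lemma nearKernel_gradQuotient_le_mul (hη : η < p₀) (hM : 1 ≤ M) (hGM : ‖G x‖ ≤ M) (hδ1 : δ ≤ 1)
    (hs : s < 1) {y : E} (hy : |P x y - p₀| ≤ η) :
    nearKernel P s δ (gradQuotient G) x y ≤ ENNReal.ofReal (M ^ (2 * η)) *
      ENNReal.ofReal (gradQuotient G x y ^ (p₀ - η) *
        ‖x - y‖ ^ ((1 - s) * (p₀ - η) - Module.finrank ℝ E)) := by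
  rw [abs_le] at hy
  unfold nearKernel
  split_ifs with h
  · rw [← ENNReal.ofReal_mul (by positivity)]
    exact ENNReal.ofReal_le_ofReal (rpow_mul_rpow_le (gradQuotient_nonneg G x y)
      ((gradQuotient_le G x y).trans hGM) hM (norm_pos_iff.2 (sub_ne_zero.2 h.1))
      (h.2.le.trans hδ1) hs (by linarith) (by linarith) (by linarith))
  · exact zero_le

/-- Away from `x` the kernel has a bound free of `s`, so the factor `1 - s` removes this region in
the limit. -/
lemma nearKernel_gradQuotient_le_const (ha : 0 < a) (hPa : ∀ x y, a ≤ P x y)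
    (hPb : ∀ x y, P x y ≤ b) (hM : 1 ≤ M) (hGM : ‖G x‖ ≤ M) (hδ1 : δ ≤ 1) (hs : s < 1)
    (hρ : 0 < ρ) {y : E} (hy : ρ ≤ ‖x - y‖) :
    nearKernel P s δ (gradQuotient G) x y ≤ (Metric.ball x 1).indicator
      (fun _ => ENNReal.ofReal (M ^ b * ρ ^ (-(Module.finrank ℝ E : ℝ)))) y := by
  unfold nearKernel
  split_ifs with h
  · have hr := norm_pos_iff.2 (sub_ne_zero.2 h.1)
    have hr1 := h.2.le.trans hδ1
    rw [indicator_of_mem (by rw [Metric.mem_ball', dist_eq_norm]; exact h.2.trans_le hδ1)]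
    refine ENNReal.ofReal_le_ofReal ?_
    have hA := gradQuotient_nonneg G x y
    have h1 : gradQuotient G x y ^ P x y ≤ M ^ b :=
      (Real.rpow_le_rpow hA ((gradQuotient_le G x y).trans hGM) (by linarith [hPa x y])).trans
        (Real.rpow_le_rpow_of_exponent_le hM (hPb x y))
    have h2 : ‖x - y‖ ^ ((1 - s) * P x y - Module.finrank ℝ E) ≤
        ρ ^ (-(Module.finrank ℝ E : ℝ)) := by
      have h3 : ‖x - y‖ ^ ((1 - s) * P x y - Module.finrank ℝ E) ≤
          ‖x - y‖ ^ (-(Module.finrank ℝ E : ℝ)) := by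
        refine Real.rpow_le_rpow_of_exponent_ge hr hr1 ?_
        have : 0 ≤ (1 - s) * P x y := mul_nonneg (by linarith) (by linarith [hPa x y])
        linarith
      exact h3.trans (Real.rpow_le_rpow_of_nonpos hρ hy (by simp))
    exact mul_le_mul h1 h2 (Real.rpow_nonneg hr.le _) (by positivity)
  · exact zero_le

end

variable {E : Type*} [NormedAddCommGroup E] [InnerProductSpace ℝ E] [FiniteDimensional ℝ E]
  [MeasurableSpace E] [BorelSpace E]

lemma setLIntegral_ball_comp_sub (f : E → ℝ≥0∞) (x : E) (r : ℝ) :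
    ∫⁻ y in Metric.ball x r, f (y - x) = ∫⁻ h in Metric.ball 0 r, f h := by
  rw [← lintegral_indicator measurableSet_ball, ← lintegral_indicator measurableSet_ball]
  conv_rhs => rw [← lintegral_sub_right_eq_self _ x]
  refine lintegral_congr fun y => ?_
  by_cases hy : y ∈ Metric.ball x r
  · rw [indicator_of_mem hy, indicator_of_mem (by simpa [dist_eq_norm] using hy)]
  · rw [indicator_of_notMem hy, indicator_of_notMem (by simpa [dist_eq_norm] using hy)]

/-- With a constant exponent the integral is explicit, and its only dependence on `s` and `ρ` is
through `ρ ^ ((1 - s) * q)`, which tends to `1` for every fixed radius. -/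
lemma lintegral_ball_gradQuotient [Nontrivial E] (G : E → E) (x : E) {q s ρ : ℝ} (hq : 0 < q)
    (hs : s < 1) (hρ : 0 < ρ) :
    ENNReal.ofReal (1 - s) * ∫⁻ y in Metric.ball x ρ, ENNReal.ofReal (gradQuotient G x y ^ q *
        ‖x - y‖ ^ ((1 - s) * q - Module.finrank ℝ E)) =
      ENNReal.ofReal (ρ ^ ((1 - s) * q) / q) * sphereMoment (G x) q := by
  have hs' : 0 < 1 - s := by linarith
  have e : ∀ y, ENNReal.ofReal (gradQuotient G x y ^ q *
        ‖x - y‖ ^ ((1 - s) * q - Module.finrank ℝ E)) =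
      ENNReal.ofReal (|inner ℝ (G x) (y - x)| ^ q) *
        ENNReal.ofReal (‖y - x‖ ^ ((1 - s) * q - q - Module.finrank ℝ E)) := by
    intro y
    rw [← ENNReal.ofReal_mul (by positivity)]
    congr 1
    by_cases hy : y = x
    · simp [hy, gradQuotient, Real.zero_rpow hq.ne']
    have hyx : 0 < ‖y - x‖ := norm_pos_iff.2 (sub_ne_zero.2 hy)
    rw [gradQuotient, norm_sub_rev x y, Real.div_rpow (abs_nonneg _) hyx.le, div_mul_eq_mul_div,
      mul_div_assoc, ← Real.rpow_sub hyx]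
    ring_nf
  simp_rw [e]
  rw [setLIntegral_ball_comp_sub (fun h => ENNReal.ofReal (|inner ℝ (G x) h| ^ q) *
    ENNReal.ofReal (‖h‖ ^ ((1 - s) * q - q - Module.finrank ℝ E))),
    lintegral_ball_inner_rpow _ _ (mul_pos hs' hq) hρ, mul_left_comm,
    ← ENNReal.ofReal_mul hs'.le, mul_comm]
  congr 2
  field_simp

/-- The value `p₀` is the essential limit of `f` at `x`. -/
def IsEssLimitAt (f : E → ℝ) (x : E) (p₀ : ℝ) : Prop :=
  ∀ η > 0, ∃ ρ > 0, ∀ᵐ y, y ∈ Metric.ball x ρ → |f y - p₀| ≤ η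

lemma IsEssLimitAt.exists_abs_sub_le {f : E → ℝ} {x : E} {p₀ : ℝ} (h : IsEssLimitAt f x p₀)
    {η : ℝ} (hη : 0 < η) : ∃ y, |f y - p₀| ≤ η := by
  obtain ⟨ρ, hρ, h⟩ := h η hη
  by_contra! hne
  have h0 : volume (Metric.ball x ρ) = 0 := by
    refine measure_mono_null (fun y hy => ?_) (ae_iff.1 h)
    simpa using And.intro (Metric.mem_ball.1 hy) (hne y)
  exact (Metric.measure_ball_pos volume x hρ).ne' h0

lemma IsEssLimitAt.mem_Icc {f : E → ℝ} {x : E} {p₀ a b : ℝ} (h : IsEssLimitAt f x p₀)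
    (ha : ∀ y, a ≤ f y) (hb : ∀ y, f y ≤ b) : p₀ ∈ Icc a b := by
  constructor
  · refine le_of_forall_pos_le_add fun η hη => ?_
    obtain ⟨y, hy⟩ := h.exists_abs_sub_le hη
    linarith [ha y, (abs_le.1 hy).2]
  · refine le_of_forall_pos_le_add fun η hη => ?_
    obtain ⟨y, hy⟩ := h.exists_abs_sub_le hη
    linarith [hb y, (abs_le.1 hy).1]

variable [Nontrivial E] {Ω : Set E} {P : E → E → ℝ} {G : E → E} {x : E} {a b δ η ρ p₀ s M : ℝ}

lemma lintegral_nearKernel_gradQuotient_le (ha : 0 < a)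
    (hPa : ∀ x y, a ≤ P x y) (hPb : ∀ x y, P x y ≤ b) (hG : Measurable G) (hη : η < p₀)
    (hM : 1 ≤ M) (hGM : ‖G x‖ ≤ M) (hδ1 : δ ≤ 1) (hs : s < 1) (hρ : 0 < ρ) (hρ1 : ρ ≤ 1)
    (hess : ∀ᵐ y, y ∈ Metric.ball x ρ → |P x y - p₀| ≤ η) :
    ENNReal.ofReal (1 - s) * ∫⁻ y in Ω, nearKernel P s δ (gradQuotient G) x y ≤
      ENNReal.ofReal (M ^ (2 * η)) *
        (ENNReal.ofReal (1 / (p₀ - η)) * sphereMoment (G x) (p₀ - η)) +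
      ENNReal.ofReal (1 - s) * (ENNReal.ofReal (M ^ b * ρ ^ (-(Module.finrank ℝ E : ℝ))) *
        volume (Metric.ball x 1)) := by
  have hq : 0 < p₀ - η := by linarith
  have hGx : Measurable (gradQuotient G x) := (measurable_gradQuotient hG).of_uncurry_left
  have hle : ∫⁻ y in Ω, nearKernel P s δ (gradQuotient G) x y ≤
      ENNReal.ofReal (M ^ (2 * η)) * (∫⁻ y in Metric.ball x ρ,
        ENNReal.ofReal (gradQuotient G x y ^ (p₀ - η) *
          ‖x - y‖ ^ ((1 - s) * (p₀ - η) - Module.finrank ℝ E))) +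
      ENNReal.ofReal (M ^ b * ρ ^ (-(Module.finrank ℝ E : ℝ))) * volume (Metric.ball x 1) := by
    rw [← lintegral_const_mul _ (by fun_prop), ← setLIntegral_const,
      ← lintegral_indicator measurableSet_ball, ← lintegral_indicator measurableSet_ball,
      ← lintegral_add_right _ (measurable_const.indicator measurableSet_ball)]
    refine (setLIntegral_le_lintegral _ _).trans (lintegral_mono_ae ?_)
    filter_upwards [hess] with y hy
    by_cases hyρ : y ∈ Metric.ball x ρ
    · rw [indicator_of_mem hyρ]
      exact (nearKernel_gradQuotient_le_mul hη hM hGM hδ1 hs (hy hyρ)).trans le_self_add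
    · refine le_add_left (nearKernel_gradQuotient_le_const ha hPa hPb hM hGM hδ1 hs hρ ?_)
      rw [Metric.mem_ball', dist_eq_norm] at hyρ
      exact not_lt.1 hyρ
  refine (mul_le_mul_right hle _).trans ?_
  rw [mul_add, mul_left_comm, lintegral_ball_gradQuotient G x hq hs hρ]
  gcongr
  exact Real.rpow_le_one hρ.le hρ1 (mul_nonneg (by linarith) hq.le)

lemma le_lintegral_nearKernel_gradQuotient (ha : 0 < a)
    (hPa : ∀ x y, a ≤ P x y) (hp₀ : 0 < p₀) (hη : 0 < η)
    (hM : 1 ≤ M) (hGM : ‖G x‖ ≤ M) (hδ1 : δ ≤ 1) (hs : s < 1) (hρ : 0 < ρ) (hρδ : ρ ≤ δ)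
    (hρΩ : Metric.ball x ρ ⊆ Ω) (hess : ∀ᵐ y, y ∈ Metric.ball x ρ → |P x y - p₀| ≤ η) :
    ENNReal.ofReal (M ^ (-(2 * η))) *
      (ENNReal.ofReal (ρ ^ ((1 - s) * (p₀ + η)) / (p₀ + η)) * sphereMoment (G x) (p₀ + η)) ≤
      ENNReal.ofReal (1 - s) * ∫⁻ y in Ω, nearKernel P s δ (gradQuotient G) x y := by
  have hq : 0 < p₀ + η := by linarith
  rw [← lintegral_ball_gradQuotient G x hq hs hρ, mul_left_comm,
    ← lintegral_const_mul' _ _ ENNReal.ofReal_ne_top]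
  refine mul_le_mul_right (le_trans (lintegral_mono_ae ?_) (lintegral_mono_set hρΩ)) _
  filter_upwards [ae_restrict_of_ae hess, ae_restrict_mem measurableSet_ball] with y hy hyρ
  have hP := abs_le.1 (hy hyρ)
  rw [Metric.mem_ball', dist_eq_norm] at hyρ
  by_cases hxy : x = y
  · simp [← hxy, gradQuotient, Real.zero_rpow hq.ne']
  have h : x ≠ y ∧ ‖x - y‖ < δ := ⟨hxy, hyρ.trans_le hρδ⟩
  unfold nearKernel
  rw [if_pos h, ← ENNReal.ofReal_mul (by positivity)]
  refine ENNReal.ofReal_le_ofReal ?_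
  -- For the lower bound, `p₀ + η` is the larger exponent and `P x y` the smaller one, the reverse
  -- of the roles in the upper bound.
  have key := rpow_mul_rpow_le (d := Module.finrank ℝ E) (η := η) (p := p₀ + η) (q := P x y)
    (gradQuotient_nonneg G x y) ((gradQuotient_le G x y).trans hGM) hM
    (norm_pos_iff.2 (sub_ne_zero.2 hxy)) (h.2.le.trans hδ1) hs (ha.trans_le (hPa x y))
    (by linarith) (by linarith)
  rw [Real.rpow_neg (by linarith), inv_mul_le_iff₀ (by positivity)]
  exact key

lemma tendsto_lintegral_nearKernel_gradQuotient (hΩ : IsOpen Ω) (hx : x ∈ Ω) (ha : 0 < a)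
    (hPa : ∀ x y, a ≤ P x y) (hPb : ∀ x y, P x y ≤ b) (hG : Measurable G)
    (hδ : 0 < δ) (hδ1 : δ ≤ 1) (hess : IsEssLimitAt (P x) x p₀)
    (hc : ContinuousAt (fun q => sphereMoment (G x) q) p₀) :
    Tendsto (fun s : ℝ => ENNReal.ofReal (1 - s) *
        ∫⁻ y in Ω, nearKernel P s δ (gradQuotient G) x y) (𝓝[<] 1)
      (𝓝 (ENNReal.ofReal (1 / p₀) * sphereMoment (G x) p₀)) := by
  have hp₀ : 0 < p₀ := ha.trans_le (hess.mem_Icc (hPa x) (hPb x)).1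
  set M : ℝ := max 1 ‖G x‖
  have hM : 1 ≤ M := le_max_left _ _
  have hM0 : 0 < M := by linarith
  have hGM : ‖G x‖ ≤ M := le_max_right _ _
  have hfin : sphereMoment (G x) p₀ ≠ ⊤ := sphereMoment_ne_top _ hp₀.le
  -- `σ = 1` gives the lower bounds, with `p₀ + η` and `M ^ (-2η)`; `σ = -1` gives the upper bounds.
  -- In both cases `η` is fixed first, then `ρ`, and `s` tends to `1` last.
  have hmul : ∀ σ : ℝ, Tendsto (fun η : ℝ => ENNReal.ofReal (M ^ (-(2 * (σ * η)))) *
      (ENNReal.ofReal (1 / (p₀ + σ * η)) * sphereMoment (G x) (p₀ + σ * η))) (𝓝[>] 0)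
      (𝓝 (ENNReal.ofReal (1 / p₀) * sphereMoment (G x) p₀)) := by
    intro σ
    have hlin : Tendsto (fun η : ℝ => p₀ + σ * η) (𝓝[>] 0) (𝓝 p₀) := by
      have : Tendsto (fun η : ℝ => p₀ + σ * η) (𝓝 0) (𝓝 (p₀ + σ * 0)) :=
        Continuous.tendsto (by fun_prop) 0
      simpa using this.mono_left nhdsWithin_le_nhds
    have t1 : Tendsto (fun η : ℝ => ENNReal.ofReal (M ^ (-(2 * (σ * η))))) (𝓝[>] 0) (𝓝 1) := by
      have : Tendsto (fun η : ℝ => M ^ (-(2 * (σ * η)))) (𝓝 0) (𝓝 (M ^ (-(2 * (σ * 0))))) :=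
        (Continuous.tendsto (Real.continuous_const_rpow hM0.ne' |>.comp (by fun_prop)) 0)
      have h2 := ENNReal.tendsto_ofReal (this.mono_left (nhdsWithin_le_nhds (s := Ioi 0)))
      simpa using h2
    have t2 : Tendsto (fun η : ℝ => ENNReal.ofReal (1 / (p₀ + σ * η))) (𝓝[>] 0)
        (𝓝 (ENNReal.ofReal (1 / p₀))) :=
      ENNReal.tendsto_ofReal (tendsto_const_nhds.div hlin hp₀.ne')
    have t3 := hc.tendsto.comp hlin
    have t4 := ENNReal.Tendsto.mul t2 (Or.inr hfin) t3 (Or.inr ENNReal.ofReal_ne_top)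
    have t5 := ENNReal.Tendsto.mul t1 (Or.inr (ENNReal.mul_ne_top ENNReal.ofReal_ne_top hfin)) t4
      (Or.inr ENNReal.one_ne_top)
    simpa using t5
  have hs1 : Tendsto (fun s : ℝ => 1 - s) (𝓝[<] 1) (𝓝 0) := by
    have : Tendsto (fun s : ℝ => 1 - s) (𝓝 1) (𝓝 (1 - 1)) := Continuous.tendsto (by fun_prop) 1
    simpa using this.mono_left nhdsWithin_le_nhds
  have hlt : ∀ᶠ s : ℝ in 𝓝[<] 1, s < 1 := self_mem_nhdsWithin
  refine tendsto_order.2 ⟨fun c hcL => ?_, fun c hcL => ?_⟩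
  · obtain ⟨η, hη1, hη⟩ := (((hmul 1).eventually_const_lt hcL).and self_mem_nhdsWithin).exists
    simp only [one_mul] at hη1
    have hη : 0 < η := hη
    obtain ⟨ρ₁, hρ₁, h₁⟩ := hess η hη
    obtain ⟨ρ₂, hρ₂, h₂⟩ := Metric.isOpen_iff.1 hΩ x hx
    set ρ := min ρ₁ (min ρ₂ δ)
    have hρ : 0 < ρ := lt_min hρ₁ (lt_min hρ₂ hδ)
    have t : Tendsto (fun s : ℝ => ENNReal.ofReal (M ^ (-(2 * η))) *
        (ENNReal.ofReal (ρ ^ ((1 - s) * (p₀ + η)) / (p₀ + η)) * sphereMoment (G x) (p₀ + η)))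
        (𝓝[<] 1) (𝓝 (ENNReal.ofReal (M ^ (-(2 * η))) *
          (ENNReal.ofReal (1 / (p₀ + η)) * sphereMoment (G x) (p₀ + η)))) := by
      refine ENNReal.Tendsto.const_mul ?_ (Or.inr ENNReal.ofReal_ne_top)
      refine ENNReal.Tendsto.mul_const ?_ (Or.inr (sphereMoment_ne_top _ (by linarith)))
      refine ENNReal.tendsto_ofReal (Tendsto.div_const ?_ _)
      have : Tendsto (fun s : ℝ => (1 - s) * (p₀ + η)) (𝓝[<] 1) (𝓝 0) := by
        simpa using hs1.mul_const (p₀ + η)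
      have h2 := ((Real.continuous_const_rpow hρ.ne').tendsto 0).comp this
      rw [Real.rpow_zero] at h2
      exact h2
    filter_upwards [t.eventually_const_lt hη1, hlt] with s hs hs1
    refine hs.trans_le (le_lintegral_nearKernel_gradQuotient ha hPa hp₀ hη hM hGM hδ1 hs1 hρ
      ((min_le_right _ _).trans (min_le_right _ _))
      ((Metric.ball_subset_ball ((min_le_right _ _).trans (min_le_left _ _))).trans h₂) ?_)
    filter_upwards [h₁] with y hy hyρ
    exact hy (Metric.ball_subset_ball (min_le_left _ _) hyρ)
  · obtain ⟨η, ⟨hη1, hη⟩, hηp⟩ := (((hmul (-1)).eventually_lt_const hcL).and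
      self_mem_nhdsWithin |>.and (eventually_nhdsWithin_of_eventually_nhds
        (gt_mem_nhds hp₀))).exists
    simp only [neg_mul, one_mul, mul_neg, neg_neg, ← sub_eq_add_neg] at hη1
    have hη : 0 < η := hη
    obtain ⟨ρ₁, hρ₁, h₁⟩ := hess η hη
    set ρ := min ρ₁ 1
    have hρ : 0 < ρ := lt_min hρ₁ one_pos
    set C := ENNReal.ofReal (M ^ b * ρ ^ (-(Module.finrank ℝ E : ℝ))) * volume (Metric.ball x 1)
    have hC : C ≠ ⊤ := ENNReal.mul_ne_top ENNReal.ofReal_ne_top measure_ball_lt_top.ne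
    have t : Tendsto (fun s : ℝ => ENNReal.ofReal (M ^ (2 * η)) *
        (ENNReal.ofReal (1 / (p₀ - η)) * sphereMoment (G x) (p₀ - η)) + ENNReal.ofReal (1 - s) * C)
        (𝓝[<] 1) (𝓝 (ENNReal.ofReal (M ^ (2 * η)) *
          (ENNReal.ofReal (1 / (p₀ - η)) * sphereMoment (G x) (p₀ - η)))) := by
      have h1 := ENNReal.Tendsto.mul_const (ENNReal.tendsto_ofReal hs1) (Or.inr hC)
      simpa using tendsto_const_nhds.add h1
    filter_upwards [t.eventually_lt_const hη1, hlt] with s hs hs1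
    refine (lintegral_nearKernel_gradQuotient_le ha hPa hPb hG hηp hM hGM hδ1 hs1
      hρ (min_le_right _ _) ?_).trans_lt hs
    filter_upwards [h₁] with y hy hyρ
    exact hy (Metric.ball_subset_ball (min_le_left _ _) hyρ)

end PointwiseLimit

/-! ### The part away from the diagonal -/

section FarPart

open scoped Classical

/-- For `r ≥ δ`, `r` and `1 + r` are comparable; this yields a kernel without singularity, with the
fixed decay exponent `d + z₀`. -/
lemma one_div_rpow_le {r δ d z z₀ z₁ : ℝ} (hδ : 0 < δ) (hr : δ ≤ r) (hz₀ : z₀ ≤ z)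
    (hz₁ : z ≤ z₁) (hd : 0 ≤ d) (hz : 0 ≤ z₀) :
    1 / r ^ (d + z) ≤ (1 + 1 / δ) ^ (d + z₁) * (1 + r) ^ (-(d + z₀)) := by
  have hr0 : 0 < r := hδ.trans_le hr
  have hc : 1 ≤ 1 + 1 / δ := by have : 0 < 1 / δ := by positivity
                                linarith
  have h1 : 1 + r ≤ (1 + 1 / δ) * r := by
    have : 1 ≤ 1 / δ * r := by
      rw [div_mul_eq_mul_div, one_mul, le_div_iff₀ hδ]; linarith
    linarith
  have h2 : (1 + r) ^ (d + z₀) ≤ (1 + r) ^ (d + z) :=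
    Real.rpow_le_rpow_of_exponent_le (by linarith) (by linarith)
  have h3 : (1 + r) ^ (d + z) ≤ ((1 + 1 / δ) * r) ^ (d + z) :=
    Real.rpow_le_rpow (by linarith) h1 (by linarith)
  rw [Real.mul_rpow (by linarith) hr0.le] at h3
  have h4 : (1 + 1 / δ) ^ (d + z) ≤ (1 + 1 / δ) ^ (d + z₁) :=
    Real.rpow_le_rpow_of_exponent_le hc (by linarith)
  have h5 : 0 < r ^ (d + z) := Real.rpow_pos_of_pos hr0 _
  rw [Real.rpow_neg (by linarith), ← div_eq_mul_inv, div_le_div_iff₀ h5 (by positivity), one_mul]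
  exact h2.trans (h3.trans (by gcongr))

variable {E : Type*} [NormedAddCommGroup E] [InnerProductSpace ℝ E]

/-- The kernel of the fractional modular at distances at least `δ`. -/
def farKernel (P : E → E → ℝ) (s δ : ℝ) (U : E → ℝ) (x y : E) : ℝ≥0∞ :=
  if δ ≤ ‖x - y‖ then
    ENNReal.ofReal (|U x - U y| ^ P x y / ‖x - y‖ ^ (Module.finrank ℝ E + s * P x y)) else 0

lemma farKernel_le {P : E → E → ℝ} {U : E → ℝ} {a b s δ : ℝ} (ha : 0 < a)
    (hPa : ∀ x y, a ≤ P x y) (hPb : ∀ x y, P x y ≤ b) (hs : 1 / 2 < s) (hs1 : s < 1)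
    (hδ : 0 < δ) (x y : E) :
    farKernel P s δ U x y ≤ ENNReal.ofReal ((1 + 1 / δ) ^ (Module.finrank ℝ E + b) *
        (1 / 2) ^ (-b)) * (ENNReal.ofReal ((1 + ‖x - y‖) ^ (-(Module.finrank ℝ E + a / 2))) *
      ((‖U x‖ₑ ^ a + ‖U x‖ₑ ^ b) + (‖U y‖ₑ ^ a + ‖U y‖ₑ ^ b))) := by
  have hb : 0 < b := ha.trans_le ((hPa x y).trans (hPb x y))
  have hab : a ≤ b := (hPa x y).trans (hPb x y)
  unfold farKernel
  split_ifs with h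
  · have hl : (1 / 2 : ℝ) ∈ Ioo (0 : ℝ) 1 := ⟨by norm_num, by norm_num⟩
    have hsub : ∀ q, 0 < q → q ≤ b →
        |U x - U y| ^ q ≤ (1 / 2) ^ (-b) * (|U x| ^ q + |U y| ^ q) := by
      intro q hq hqb
      have h1 := add_rpow_le_of_mem_Ioo hl hq.le hqb (abs_nonneg (U x)) (abs_nonneg (U y))
      rw [mul_add]
      norm_num at h1 ⊢
      exact (Real.rpow_le_rpow (abs_nonneg _) (abs_sub (U x) (U y)) hq.le).trans h1
    have h1 : |U x - U y| ^ P x y ≤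
        (1 / 2) ^ (-b) * ((|U x| ^ a + |U x| ^ b) + (|U y| ^ a + |U y| ^ b)) := by
      have := rpow_le_rpow_add_rpow (hPa x y) (hPb x y) ha (abs_nonneg (U x - U y))
      linarith [hsub a ha hab, hsub b hb le_rfl]
    -- For `1/2 < s < 1` the number `s * P x y` lies between `a / 2` and `b`. The decay exponent `d
    -- + a / 2` exceeds the dimension, so the kernel is integrable.
    have h2 := one_div_rpow_le (d := Module.finrank ℝ E) (z := s * P x y) (z₀ := a / 2) (z₁ := b)
      hδ h (by nlinarith [hPa x y]) (by nlinarith [hPa x y, hPb x y]) (by positivity)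
      (by positivity)
    have e : (‖U x‖ₑ ^ a + ‖U x‖ₑ ^ b) + (‖U y‖ₑ ^ a + ‖U y‖ₑ ^ b) =
        ENNReal.ofReal ((|U x| ^ a + |U x| ^ b) + (|U y| ^ a + |U y| ^ b)) := by
      rw [ENNReal.ofReal_add (by positivity) (by positivity),
        ENNReal.ofReal_add (by positivity) (by positivity),
        ENNReal.ofReal_add (by positivity) (by positivity)]
      simp only [Real.enorm_eq_ofReal_abs, ENNReal.ofReal_rpow_of_nonneg (abs_nonneg _) ha.le,
        ENNReal.ofReal_rpow_of_nonneg (abs_nonneg _) hb.le]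
    rw [e, ← ENNReal.ofReal_mul (by positivity), ← ENNReal.ofReal_mul (by positivity)]
    refine ENNReal.ofReal_le_ofReal ?_
    rw [div_eq_mul_one_div]
    calc _ ≤ _ := mul_le_mul h1 h2 (by positivity) (by positivity)
      _ = _ := by ring
  · exact zero_le

lemma ofReal_div_eq_nearKernel_add_farKernel {P : E → E → ℝ} {U : E → ℝ} {s δ : ℝ}
    (hP : ∀ x y, 0 < P x y) (hδ : 0 < δ) (x y : E) :
    ENNReal.ofReal (|U x - U y| ^ P x y / ‖x - y‖ ^ (Module.finrank ℝ E + s * P x y)) =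
      nearKernel P s δ (diffQuotient U) x y + farKernel P s δ U x y := by
  unfold nearKernel farKernel
  by_cases hxy : x = y
  · have h1 := hP y y
    simp [hxy, Real.zero_rpow h1.ne', hδ]
  by_cases h : ‖x - y‖ < δ
  · have hr := norm_pos_iff.2 (sub_ne_zero.2 hxy)
    rw [if_pos ⟨hxy, h⟩, if_neg (not_le.2 h), add_zero, diffQuotient,
      Real.div_rpow (abs_nonneg _) hr.le, div_mul_eq_mul_div, mul_div_assoc, ← Real.rpow_sub hr,
      div_eq_mul_inv, ← Real.rpow_neg hr.le]
    ring_nf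
  · rw [if_neg (fun h' => h h'.2), if_pos (not_lt.1 h), zero_add]

variable [FiniteDimensional ℝ E] [MeasurableSpace E] [BorelSpace E]

/-- The majorant is an integrable function of `x - y` times a function of `x` alone or of `y` alone;
Tonelli and translation invariance bound it by a product of two finite integrals. -/
lemma lintegral_farKernel_le {Ω : Set E} {P : E → E → ℝ} {U : E → ℝ} {a b δ : ℝ} (ha : 0 < a)
    (hPa : ∀ x y, a ≤ P x y) (hPb : ∀ x y, P x y ≤ b) (hU : Measurable U)
    (hUa : ∫⁻ x in Ω, ‖U x‖ₑ ^ a < ⊤) (hUb : ∫⁻ x in Ω, ‖U x‖ₑ ^ b < ⊤) (hδ : 0 < δ) :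
    ∃ C : ℝ≥0∞, C ≠ ⊤ ∧ ∀ s, 1 / 2 < s → s < 1 →
      ∫⁻ x in Ω, ∫⁻ y in Ω, farKernel P s δ U x y ≤ C := by
  set k : E → ℝ≥0∞ := fun h => ENNReal.ofReal ((1 + ‖h‖) ^ (-(Module.finrank ℝ E + a / 2)))
  set m : E → ℝ≥0∞ := fun x => ‖U x‖ₑ ^ a + ‖U x‖ₑ ^ b
  set c := ENNReal.ofReal ((1 + 1 / δ) ^ (Module.finrank ℝ E + b) * (1 / 2) ^ (-b))
  have hm : Measurable m := by fun_prop
  have hk : Measurable k := by fun_prop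
  have hkfin : ∫⁻ h, k h < ⊤ := by
    have := integrable_one_add_norm (E := E) (μ := volume) (r := Module.finrank ℝ E + a / 2)
      (by linarith)
    refine lt_of_eq_of_lt (lintegral_congr fun h => ?_) this.2
    rw [Real.enorm_of_nonneg (by positivity)]
  have hmfin : ∫⁻ x in Ω, m x < ⊤ := by
    rw [lintegral_add_left (by fun_prop)]
    exact ENNReal.add_lt_top.2 ⟨hUa, hUb⟩
  have hkx : ∀ x, ∫⁻ y in Ω, k (x - y) ≤ ∫⁻ h, k h := fun x =>
    (setLIntegral_le_lintegral _ _).trans_eq (lintegral_sub_left_eq_self k x)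
  refine ⟨c * (((∫⁻ h, k h) * ∫⁻ x in Ω, m x) + (∫⁻ h, k h) * ∫⁻ x in Ω, m x),
    ENNReal.mul_ne_top ENNReal.ofReal_ne_top
      (ENNReal.add_ne_top.2 ⟨(ENNReal.mul_lt_top hkfin hmfin).ne,
        (ENNReal.mul_lt_top hkfin hmfin).ne⟩), fun s hs hs1 => ?_⟩
  calc ∫⁻ x in Ω, ∫⁻ y in Ω, farKernel P s δ U x y
      ≤ ∫⁻ x in Ω, ∫⁻ y in Ω, c * (k (x - y) * (m x + m y)) := by
        gcongr with x y
        exact farKernel_le ha hPa hPb hs hs1 hδ x y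
    _ = c * ((∫⁻ x in Ω, ∫⁻ y in Ω, k (x - y) * m x) +
          ∫⁻ x in Ω, ∫⁻ y in Ω, k (x - y) * m y) := by
        have h1 : ∀ x, ∫⁻ y in Ω, c * (k (x - y) * (m x + m y)) =
            c * ((∫⁻ y in Ω, k (x - y) * m x) + ∫⁻ y in Ω, k (x - y) * m y) := fun x => by
          rw [lintegral_const_mul' _ _ ENNReal.ofReal_ne_top, ← lintegral_add_left (by fun_prop)]
          simp only [mul_add]
          rfl
        rw [lintegral_congr h1, lintegral_const_mul' _ _ ENNReal.ofReal_ne_top,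
          lintegral_add_left]
        exact Measurable.lintegral_prod_right' (f := fun z : E × E => k (z.1 - z.2) * m z.1)
          (by fun_prop)
    _ ≤ _ := by
        gcongr
        · rw [← lintegral_const_mul _ hm]
          gcongr with x
          rw [lintegral_mul_const _ (by fun_prop)]
          exact mul_le_mul_left (hkx x) _
        · rw [lintegral_lintegral_swap (by fun_prop), ← lintegral_const_mul _ hm]
          gcongr with y
          rw [lintegral_mul_const _ (by fun_prop)]
          exact mul_le_mul_left
            ((setLIntegral_le_lintegral _ _).trans_eq (lintegral_sub_right_eq_self k y)) _

end FarPart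

/-! ### Passage to the limit in the modulars -/

section Convergence

variable {E : Type*} [NormedAddCommGroup E] [InnerProductSpace ℝ E] [FiniteDimensional ℝ E]
  [MeasurableSpace E] [BorelSpace E] [Nontrivial E] {Ω : Set E} {P : E → E → ℝ} {U : E → ℝ}
  {G : E → E} {p₀ : E → ℝ} {a b : ℝ}

/-- The majorant for dominated convergence in `x`, free of `s`. -/
lemma lintegral_nearKernel_gradQuotient_le_enorm {s δ : ℝ} (ha : 0 < a) (hPa : ∀ x y, a ≤ P x y)
    (hPb : ∀ x y, P x y ≤ b) (hs : s < 1) (hδ1 : δ ≤ 1) (x : E) :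
    ENNReal.ofReal (1 - s) * ∫⁻ y in Ω, nearKernel P s δ (gradQuotient G) x y ≤
      (‖G x‖ₑ ^ a + ‖G x‖ₑ ^ b) *
        ((volume : Measure E).toSphere univ * ENNReal.ofReal (1 / a)) := by
  have hb : 0 < b := ha.trans_le ((hPa x x).trans (hPb x x))
  rw [← ofReal_mul_lintegral_ball_norm_rpow ha hs, mul_left_comm]
  refine mul_le_mul_right ?_ _
  rw [← setLIntegral_ball_comp_sub _ x, ← lintegral_const_mul _ (by fun_prop),
    ← lintegral_indicator measurableSet_ball]
  refine (setLIntegral_le_lintegral _ _).trans (lintegral_mono fun y => ?_)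
  refine (nearKernel_le ha hPa hPb hs hδ1 (gradQuotient_nonneg G) x y).trans ?_
  split_ifs with h
  · rw [indicator_of_mem (by rw [Metric.mem_ball', dist_eq_norm]; exact h.2.trans_le hδ1),
      norm_sub_rev y]
    have : ‖gradQuotient G x y‖ₑ ≤ ‖G x‖ₑ := by
      rw [Real.enorm_of_nonneg (gradQuotient_nonneg G x y), ← ofReal_norm]
      exact ENNReal.ofReal_le_ofReal (gradQuotient_le G x y)
    gcongr
  · exact zero_le

/-- The limiting density. -/
def limitDensity (G : E → E) (p₀ : E → ℝ) (x : E) : ℝ≥0∞ :=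
  ENNReal.ofReal (1 / p₀ x) * sphereMoment (G x) (p₀ x)

lemma tendsto_nearModular_gradQuotient (hΩ : IsOpen Ω) (ha : 0 < a)
    (hP : Measurable (Function.uncurry P)) (hPa : ∀ x y, a ≤ P x y) (hPb : ∀ x y, P x y ≤ b)
    (hG : Measurable G) (hGa : ∫⁻ x in Ω, ‖G x‖ₑ ^ a < ⊤) (hGb : ∫⁻ x in Ω, ‖G x‖ₑ ^ b < ⊤)
    (hess : ∀ᵐ x ∂(volume.restrict Ω), IsEssLimitAt (P x) x (p₀ x))
    (hc : ∀ (g : E) (q : ℝ), 0 < q → ContinuousAt (fun q => sphereMoment g q) q) :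
    ∫⁻ x in Ω, limitDensity G p₀ x < ⊤ ∧ ∀ δ, 0 < δ → δ ≤ 1 →
      Tendsto (fun s => nearModular Ω P s δ (gradQuotient G)) (𝓝[<] 1)
        (𝓝 (∫⁻ x in Ω, limitDensity G p₀ x)) := by
  set W := (volume : Measure E).toSphere univ * ENNReal.ofReal (1 / a)
  have hW : W < ⊤ := ENNReal.mul_lt_top (measure_lt_top _ _) ENNReal.ofReal_lt_top
  set bound : E → ℝ≥0∞ := fun x => (‖G x‖ₑ ^ a + ‖G x‖ₑ ^ b) * W
  have hbound : ∫⁻ x in Ω, bound x < ⊤ := by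
    rw [lintegral_mul_const _ (by fun_prop), lintegral_add_left (by fun_prop)]
    exact ENNReal.mul_lt_top (ENNReal.add_lt_top.2 ⟨hGa, hGb⟩) hW
  have hlt : ∀ᶠ s : ℝ in 𝓝[<] 1, s < 1 := self_mem_nhdsWithin
  have hlim : ∀ δ, 0 < δ → δ ≤ 1 → ∀ᵐ x ∂(volume.restrict Ω),
      Tendsto (fun s : ℝ => ENNReal.ofReal (1 - s) *
        ∫⁻ y in Ω, nearKernel P s δ (gradQuotient G) x y) (𝓝[<] 1) (𝓝 (limitDensity G p₀ x)) := by
    intro δ hδ hδ1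
    filter_upwards [hess, ae_restrict_mem hΩ.measurableSet] with x hx hxΩ
    exact tendsto_lintegral_nearKernel_gradQuotient hΩ hxΩ ha hPa hPb hG hδ hδ1 hx
      (hc _ _ (ha.trans_le (hx.mem_Icc (hPa x) (hPb x)).1))
  constructor
  · refine lt_of_le_of_lt (lintegral_mono_ae ?_) hbound
    filter_upwards [hlim 1 one_pos le_rfl] with x hx
    exact le_of_tendsto hx (hlt.mono fun s hs =>
      lintegral_nearKernel_gradQuotient_le_enorm ha hPa hPb hs le_rfl x)
  · intro δ hδ hδ1
    have hmeas : ∀ s, Measurable fun x => ∫⁻ y in Ω, nearKernel P s δ (gradQuotient G) x y :=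
      fun s => (measurable_nearKernel hP (measurable_gradQuotient hG) s δ).lintegral_prod_right'
    have := tendsto_lintegral_filter_of_dominated_convergence (μ := volume.restrict Ω) bound
      (Eventually.of_forall fun s => (hmeas s).const_mul (ENNReal.ofReal (1 - s)))
      (hlt.mono fun s hs => Eventually.of_forall fun x =>
        lintegral_nearKernel_gradQuotient_le_enorm ha hPa hPb hs hδ1 x)
      hbound.ne (hlim δ hδ hδ1)
    refine this.congr fun s => ?_
    rw [nearModular, lintegral_const_mul' _ _ ENNReal.ofReal_ne_top]

/-- The fractional modulars converge once the first order Taylor expansion of `U` holds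
in `L^a` and `L^b`. -/
theorem tendsto_fractional_modular (hΩ : IsOpen Ω) (ha : 0 < a)
    (hP : Measurable (Function.uncurry P)) (hPa : ∀ x y, a ≤ P x y) (hPb : ∀ x y, P x y ≤ b)
    (hU : Measurable U) (hUa : ∫⁻ x in Ω, ‖U x‖ₑ ^ a < ⊤) (hUb : ∫⁻ x in Ω, ‖U x‖ₑ ^ b < ⊤)
    (hG : Measurable G) (hGa : ∫⁻ x in Ω, ‖G x‖ₑ ^ a < ⊤) (hGb : ∫⁻ x in Ω, ‖G x‖ₑ ^ b < ⊤)
    (hess : ∀ᵐ x ∂(volume.restrict Ω), IsEssLimitAt (P x) x (p₀ x))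
    (hc : ∀ (g : E) (q : ℝ), 0 < q → ContinuousAt (fun q => sphereMoment g q) q)
    (htaylor : ∀ q ∈ ({a, b} : Set ℝ), ∀ ε : ℝ≥0∞, 0 < ε → ∃ δ > 0, ∀ h : E, ‖h‖ < δ →
      ∫⁻ x in Ω ∩ {x | x + h ∈ Ω}, ‖U (x + h) - U x - inner ℝ (G x) h‖ₑ ^ q ≤ ε * ‖h‖ₑ ^ q) :
    Tendsto (fun s : ℝ => ENNReal.ofReal (s * (1 - s)) * ∫⁻ x in Ω, ∫⁻ y in Ω,
      ENNReal.ofReal (|U x - U y| ^ P x y / ‖x - y‖ ^ (Module.finrank ℝ E + s * P x y)))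
      (𝓝[<] 1) (𝓝 (∫⁻ x in Ω, limitDensity G p₀ x)) := by
  have hb : 0 < b := ha.trans_le ((hPa 0 0).trans (hPb 0 0))
  have hP0 : ∀ x y, 0 < P x y := fun x y => ha.trans_le (hPa x y)
  obtain ⟨hLfin, hD⟩ := tendsto_nearModular_gradQuotient hΩ ha hP hPa hPb hG hGa hGb hess hc
  set L := ∫⁻ x in Ω, limitDensity G p₀ x
  set W := (volume : Measure E).toSphere univ * ENNReal.ofReal (1 / a)
  have hW : W ≠ ⊤ := (ENNReal.mul_lt_top (measure_lt_top _ _) ENNReal.ofReal_lt_top).ne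
  have hsplit : ∀ s δ : ℝ, 0 < s → s < 1 → 0 < δ →
      ENNReal.ofReal (s * (1 - s)) * ∫⁻ x in Ω, ∫⁻ y in Ω,
        ENNReal.ofReal (|U x - U y| ^ P x y / ‖x - y‖ ^ (Module.finrank ℝ E + s * P x y)) =
      ENNReal.ofReal s * (nearModular Ω P s δ (diffQuotient U) +
        ENNReal.ofReal (1 - s) * ∫⁻ x in Ω, ∫⁻ y in Ω, farKernel P s δ U x y) := by
    intro s δ hs hs1 hδ
    have hm := measurable_nearKernel hP (measurable_diffQuotient hU) s δ
    simp_rw [ofReal_div_eq_nearKernel_add_farKernel hP0 hδ,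
      lintegral_add_left (hm.of_uncurry_left)]
    have hm2 : Measurable fun x => ∫⁻ y in Ω, nearKernel P s δ (diffQuotient U) x y :=
      hm.lintegral_prod_right'
    rw [lintegral_add_left hm2, ENNReal.ofReal_mul hs.le, mul_assoc, mul_add,
      nearModular]
  have herr : ∀ ε : ℝ≥0∞, 0 < ε → ∃ δ > 0, δ ≤ 1 ∧ ∀ s < 1,
      nearModular Ω P s δ (taylorError U G) ≤ 2 * ε * W := by
    intro ε hε
    obtain ⟨δ₁, hδ₁, h₁⟩ := htaylor a (by simp) ε hε
    obtain ⟨δ₂, hδ₂, h₂⟩ := htaylor b (by simp) ε hε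
    refine ⟨min δ₁ (min δ₂ 1), lt_min hδ₁ (lt_min hδ₂ one_pos),
      (min_le_right _ _).trans (min_le_right _ _), fun s hs => ?_⟩
    refine nearModular_taylorError_le hΩ.measurableSet hU hG ha hb hPa hPb hs
      ((min_le_right _ _).trans (min_le_right _ _)) ?_
    rintro q (rfl | rfl) h hh
    · exact h₁ h (hh.trans_le (min_le_left _ _))
    · exact h₂ h (hh.trans_le ((min_le_right _ _).trans (min_le_left _ _)))
  have hle1 : ∀ s δ l : ℝ, l ∈ Ioo (0 : ℝ) 1 → nearModular Ω P s δ (diffQuotient U) ≤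
      ENNReal.ofReal ((1 - l) ^ (-b)) * nearModular Ω P s δ (gradQuotient G) +
        ENNReal.ofReal (l ^ (-b)) * nearModular Ω P s δ (taylorError U G) := fun s δ l hl =>
    nearModular_le_of_le_add hP (measurable_gradQuotient hG) (fun x y => (hP0 x y).le) hPb hl
      (diffQuotient_nonneg U) (gradQuotient_nonneg G) (taylorError_nonneg U G)
      (diffQuotient_le_add U G)
  have hle2 : ∀ s δ l : ℝ, l ∈ Ioo (0 : ℝ) 1 → nearModular Ω P s δ (gradQuotient G) ≤
      ENNReal.ofReal ((1 - l) ^ (-b)) * nearModular Ω P s δ (diffQuotient U) +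
        ENNReal.ofReal (l ^ (-b)) * nearModular Ω P s δ (taylorError U G) := fun s δ l hl =>
    nearModular_le_of_le_add hP (measurable_diffQuotient hU) (fun x y => (hP0 x y).le) hPb hl
      (gradQuotient_nonneg G) (diffQuotient_nonneg U) (taylorError_nonneg U G)
      (gradQuotient_le_add U G)
  have hlam : ∀ X : ℝ≥0∞, X ≠ ⊤ →
      Tendsto (fun l : ℝ => ENNReal.ofReal ((1 - l) ^ (-b)) * X) (𝓝[>] 0) (𝓝 X) := by
    intro X hX
    have h1 : Tendsto (fun l : ℝ => (1 - l) ^ (-b)) (𝓝 0) (𝓝 1) := by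
      have h2 : Tendsto (fun l : ℝ => 1 - l) (𝓝 0) (𝓝 1) := by
        have : Tendsto (fun l : ℝ => 1 - l) (𝓝 0) (𝓝 (1 - 0)) := Continuous.tendsto (by fun_prop) 0
        simpa using this
      simpa using h2.rpow_const (p := -b) (Or.inl one_ne_zero)
    have h3 := ENNReal.Tendsto.mul_const
      (ENNReal.tendsto_ofReal (h1.mono_left (nhdsWithin_le_nhds (s := Ioi 0)))) (Or.inr hX)
    simpa using h3
  -- `l ^ (-b)` blows up as `l` tends to `0`, so `ε`, and then `δ`, are chosen after `l`.
  have heps : ∀ (l : ℝ) (X c : ℝ≥0∞), X < c →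
      ∃ ε : ℝ≥0∞, 0 < ε ∧ X + ENNReal.ofReal (l ^ (-b)) * (2 * ε * W) < c := by
    intro l X c hXc
    have h1 : Tendsto (fun ε : ℝ≥0∞ => X + ENNReal.ofReal (l ^ (-b)) * (2 * ε * W)) (𝓝[>] 0)
        (𝓝 (X + ENNReal.ofReal (l ^ (-b)) * (2 * 0 * W))) := by
      refine Tendsto.mono_left ?_ nhdsWithin_le_nhds
      refine tendsto_const_nhds.add (ENNReal.Tendsto.const_mul (ENNReal.Tendsto.mul_const
        (ENNReal.Tendsto.const_mul tendsto_id (Or.inr (by simp))) (Or.inr hW))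
        (Or.inr ENNReal.ofReal_ne_top))
    simp only [mul_zero, zero_mul, add_zero] at h1
    obtain ⟨ε, h, hε⟩ := ((h1.eventually_lt_const hXc).and self_mem_nhdsWithin).exists
    exact ⟨ε, hε, h⟩
  have hlt : ∀ᶠ s : ℝ in 𝓝[<] 1, s < 1 := self_mem_nhdsWithin
  have hgt : ∀ᶠ s : ℝ in 𝓝[<] 1, 1 / 2 < s :=
    eventually_nhdsWithin_of_eventually_nhds (lt_mem_nhds (by norm_num))
  have hs0 : Tendsto (fun s : ℝ => ENNReal.ofReal (1 - s)) (𝓝[<] 1) (𝓝 0) := by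
    have : Tendsto (fun s : ℝ => ENNReal.ofReal (1 - s)) (𝓝 1) (𝓝 (ENNReal.ofReal (1 - 1))) :=
      ENNReal.tendsto_ofReal (Continuous.tendsto (by fun_prop) 1)
    simpa using this.mono_left nhdsWithin_le_nhds
  have hs1 : Tendsto (fun s : ℝ => ENNReal.ofReal s) (𝓝[<] 1) (𝓝 1) := by
    have : Tendsto (fun s : ℝ => ENNReal.ofReal s) (𝓝 1) (𝓝 (ENNReal.ofReal 1)) :=
      ENNReal.tendsto_ofReal tendsto_id
    simpa using this.mono_left nhdsWithin_le_nhds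
  have hIoo : ∀ᶠ l : ℝ in 𝓝[>] 0, l ∈ Ioo (0 : ℝ) 1 := Ioo_mem_nhdsGT one_pos
  refine tendsto_order.2 ⟨fun c hcL => ?_, fun c hcL => ?_⟩
  -- The gap between `c` and `c'` absorbs the factor `s`, and the gap between `c'` and `L` absorbs
  -- the quasi-triangle losses.
  · obtain ⟨c', hcc', hc'L⟩ := exists_between hcL
    have hc'top : c' ≠ ⊤ := (hc'L.trans hLfin).ne
    obtain ⟨l, hl1, hl⟩ := (((hlam c' hc'top).eventually_lt_const hc'L).and hIoo).exists
    obtain ⟨ε, hε, hεL⟩ := heps l _ _ hl1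
    obtain ⟨δ, hδ, hδ1, hδerr⟩ := herr ε hε
    have t : Tendsto (fun s : ℝ => ENNReal.ofReal s * c') (𝓝[<] 1) (𝓝 c') := by
      simpa using ENNReal.Tendsto.mul_const hs1 (Or.inr hc'top)
    filter_upwards [hlt, hgt, t.eventually_const_lt hcc', (hD δ hδ hδ1).eventually_const_lt hεL]
      with s h1 h2 h3 h4
    rw [hsplit s δ (by linarith) h1 hδ]
    refine h3.trans_le (mul_le_mul_right (le_trans ?_ le_self_add) _)
    -- If the modular of the difference quotient were below `c'`, then `hle2` would put that of the
    -- gradient quotient below the value it exceeds by `h4`.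
    by_contra! hlt'
    refine absurd h4 (not_lt.2 ((hle2 s δ l hl).trans ?_))
    gcongr
    exact hδerr s h1
  · obtain ⟨l, hl1, hl⟩ := (((hlam L hLfin.ne).eventually_lt_const hcL).and hIoo).exists
    obtain ⟨ε, hε, hεL⟩ := heps l _ _ hl1
    obtain ⟨δ, hδ, hδ1, hδerr⟩ := herr ε hε
    obtain ⟨C, hC, hfar⟩ := lintegral_farKernel_le ha hPa hPb hU hUa hUb hδ
    have t : Tendsto (fun s : ℝ => ENNReal.ofReal ((1 - l) ^ (-b)) *
        nearModular Ω P s δ (gradQuotient G) + ENNReal.ofReal (l ^ (-b)) * (2 * ε * W) +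
        ENNReal.ofReal (1 - s) * C) (𝓝[<] 1)
        (𝓝 (ENNReal.ofReal ((1 - l) ^ (-b)) * L + ENNReal.ofReal (l ^ (-b)) * (2 * ε * W) +
          0 * C)) :=
      ((ENNReal.Tendsto.const_mul (hD δ hδ hδ1) (Or.inr ENNReal.ofReal_ne_top)).add
        tendsto_const_nhds).add (ENNReal.Tendsto.mul_const hs0 (Or.inr hC))
    rw [zero_mul, add_zero] at t
    filter_upwards [hlt, hgt, t.eventually_lt_const hεL] with s h1 h2 h3
    rw [hsplit s δ (by linarith) h1 hδ]
    refine lt_of_le_of_lt ?_ h3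
    calc _ ≤ 1 * (nearModular Ω P s δ (diffQuotient U) +
          ENNReal.ofReal (1 - s) * ∫⁻ x in Ω, ∫⁻ y in Ω, farKernel P s δ U x y) := by
          gcongr
          exact ENNReal.ofReal_le_one.2 h1.le
      _ ≤ _ := by
          rw [one_mul]
          gcongr
          · refine (hle1 s δ l hl).trans ?_
            gcongr
            exact hδerr s h1
          · exact hfar s h2 h1

end Convergence

/-! ### The variable exponent: continuity and a measurable representative -/

section Exponent

variable {n : ℕ} {Ω : Set (EuclideanSpace ℝ (Fin n))}
  {p : EuclideanSpace ℝ (Fin n) → EuclideanSpace ℝ (Fin n) → ℝ}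

lemma abs_sub_le_osc {f : EuclideanSpace ℝ (Fin n) → ℝ} {S : Set (EuclideanSpace ℝ (Fin n))}
    (hf : Bornology.IsBounded (f '' S)) {x y : EuclideanSpace ℝ (Fin n)} (hx : x ∈ S)
    (hy : y ∈ S) : |f y - f x| ≤ osc f S := by
  have hx' := mem_image_of_mem f hx
  have hy' := mem_image_of_mem f hy
  rw [abs_le, osc]
  constructor <;>
    linarith [le_csSup hf.bddAbove hx', le_csSup hf.bddAbove hy', csInf_le hf.bddBelow hx',
      csInf_le hf.bddBelow hy']

/-- The log-Hölder condition implies continuity of `p x` at `x`. -/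
lemma LogHolder.exists_abs_sub_le (hΩ : IsOpen Ω) (h : LogHolder Ω p)
    {x : EuclideanSpace ℝ (Fin n)} (hx : x ∈ Ω) {η : ℝ} (hη : 0 < η) :
    ∃ ρ > 0, ∀ y ∈ Metric.ball x ρ, |p x y - p x x| ≤ η := by
  obtain ⟨L, hL, h⟩ := h
  have hd : 0 < min (Metric.infEDist x (frontier Ω)) 1 := by
    refine lt_min ?_ one_pos
    rw [Metric.infEDist_pos_iff_notMem_closure, isClosed_frontier.closure_eq, hΩ.frontier_eq]
    exact fun h => h.2 hx
  have t1 : Tendsto (fun r : ℝ => ENNReal.ofReal r) (𝓝[>] 0) (𝓝 0) := by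
    have h0 : Tendsto (fun r : ℝ => r) (𝓝[>] 0) (𝓝 0) := nhdsWithin_le_nhds
    simpa using ENNReal.tendsto_ofReal h0
  -- Taking logarithms, the hypothesis reads `osc * (-log r) ≤ log L`; once `-log r > log L / η` it
  -- forces `osc ≤ η`.
  have t2 : ∀ᶠ r : ℝ in 𝓝[>] 0, Real.log r < -(Real.log L / η) :=
    Real.tendsto_log_nhdsGT_zero.eventually_lt_atBot _
  obtain ⟨r, ⟨hr1, hr2⟩, hr0⟩ :=
    (((t1.eventually_lt_const hd).and t2).and self_mem_nhdsWithin).exists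
  have hr0 : 0 < r := hr0
  obtain ⟨hb, hosc⟩ := h x hx r hr0 hr1
  refine ⟨r, hr0, fun y hy => (abs_sub_le_osc hb (Metric.mem_ball_self hr0) hy).trans ?_⟩
  have h1 := Real.log_le_log (Real.rpow_pos_of_pos hr0 _) hosc
  rw [Real.log_rpow hr0] at h1
  have hlogL : 0 ≤ Real.log L := Real.log_nonneg hL
  by_contra! hlt
  have h2 : Real.log L / η * η = Real.log L := div_mul_cancel₀ _ hη.ne'
  have h3 : 0 ≤ Real.log L / η := by positivity
  nlinarith

/-- The exponent agrees almost everywhere with a measurable function that satisfies its bounds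
everywhere. -/
lemma ExponentBounds.exists_measurable (hp : AEMeasurable (Function.uncurry p)
    (volume.restrict (Ω ×ˢ Ω))) (hb : ExponentBounds Ω p) :
    ∃ P : EuclideanSpace ℝ (Fin n) → EuclideanSpace ℝ (Fin n) → ℝ,
      Measurable (Function.uncurry P) ∧ (∀ x y, (pMinus Ω p).toReal ≤ P x y) ∧
      (∀ x y, P x y ≤ (pPlus Ω p).toReal) ∧
      ∀ᵐ x ∂(volume.restrict Ω), ∀ᵐ y ∂(volume.restrict Ω), P x y = p x y := by
  obtain ⟨g, hgm, hpg⟩ := hp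
  obtain ⟨h1, h2, h3⟩ := hb
  have hm : pMinus Ω p ≠ ⊤ := (h2.trans_lt h3).ne
  have hab : (pMinus Ω p).toReal ≤ (pPlus Ω p).toReal := ENNReal.toReal_mono h3.ne h2
  have ha : 0 < (pMinus Ω p).toReal := ENNReal.toReal_pos (one_pos.trans h1).ne' hm
  have hae : ∀ᵐ z ∂(volume.restrict (Ω ×ˢ Ω)),
      max (pMinus Ω p).toReal (min (pPlus Ω p).toReal (g z)) = p z.1 z.2 := by
    filter_upwards [hpg, ae_essInf_le (f := fun z : EuclideanSpace ℝ (Fin n) ×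
      EuclideanSpace ℝ (Fin n) => ENNReal.ofReal (p z.1 z.2)) (μ := volume.restrict (Ω ×ˢ Ω)),
      ENNReal.ae_le_essSup (μ := volume.restrict (Ω ×ˢ Ω)) (fun z : EuclideanSpace ℝ (Fin n) ×
      EuclideanSpace ℝ (Fin n) => ENNReal.ofReal (p z.1 z.2))] with z hz hz1 hz2
    rw [← hz]
    change pMinus Ω p ≤ _ at hz1
    change _ ≤ pPlus Ω p at hz2
    rw [← ENNReal.ofReal_toReal hm, ENNReal.ofReal_le_ofReal_iff'] at hz1
    rw [← ENNReal.ofReal_toReal h3.ne, ENNReal.ofReal_le_ofReal_iff ENNReal.toReal_nonneg] at hz2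
    -- Truncation at `0` inside `ENNReal.ofReal` loses nothing here, because the lower bound
    -- `pMinus` is positive.
    have hz1' := hz1.resolve_right (not_le.2 ha)
    simp [Function.uncurry, hz1', hz2]
  refine ⟨fun x y => max (pMinus Ω p).toReal (min (pPlus Ω p).toReal (g (x, y))), ?_,
    fun x y => le_max_left _ _, fun x y => max_le hab (min_le_left _ _), ?_⟩
  · exact measurable_const.max (measurable_const.min hgm)
  · rw [Measure.volume_eq_prod, ← Measure.prod_restrict] at hae
    exact Measure.ae_ae_of_ae_prod hae

/-- Almost everywhere equality says nothing about `P x x`; the value `p x x` is instead recovered as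
the essential limit of `P x` at `x`. -/
lemma LogHolder.isEssLimitAt (hΩ : IsOpen Ω) (h : LogHolder Ω p)
    {P : EuclideanSpace ℝ (Fin n) → EuclideanSpace ℝ (Fin n) → ℝ}
    {x : EuclideanSpace ℝ (Fin n)} (hx : x ∈ Ω)
    (hP : ∀ᵐ y ∂(volume.restrict Ω), P x y = p x y) : IsEssLimitAt (P x) x (p x x) := by
  intro η hη
  obtain ⟨ρ₁, hρ₁, h₁⟩ := h.exists_abs_sub_le hΩ hx hη
  obtain ⟨ρ₂, hρ₂, h₂⟩ := Metric.isOpen_iff.1 hΩ x hx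
  refine ⟨min ρ₁ ρ₂, lt_min hρ₁ hρ₂, ?_⟩
  filter_upwards [(ae_restrict_iff' hΩ.measurableSet).1 hP] with y hy hyρ
  rw [hy (h₂ (Metric.ball_subset_ball (min_le_right _ _) hyρ))]
  exact h₁ y (Metric.ball_subset_ball (min_le_left _ _) hyρ)

end Exponent

/-! ### Using extensions to the whole space -/

section Extension

variable {n : ℕ} {Ω : Set (EuclideanSpace ℝ (Fin n))}

lemma memLp_of_forall_coord {q : ℝ≥0∞} {μ : Measure (EuclideanSpace ℝ (Fin n))}
    {H : EuclideanSpace ℝ (Fin n) → EuclideanSpace ℝ (Fin n)}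
    (h : ∀ i, MemLp (fun x => H x i) q μ) : MemLp H q μ := by
  have e : H = fun x => ∑ i, H x i • EuclideanSpace.single i (1 : ℝ) := by
    funext x
    ext j
    simp [Finset.sum_apply, Pi.single_apply]
  rw [e]
  exact memLp_finsetSum _ fun i _ =>
    (LinearMap.toContinuousLinearMap (LinearMap.toSpanSingleton ℝ (EuclideanSpace ℝ (Fin n))
      (EuclideanSpace.single i (1 : ℝ)))).comp_memLp' (h i)

lemma MemLp.lintegral_enorm_rpow_lt_top {α F : Type*} [MeasurableSpace α] [NormedAddCommGroup F]
    {μ : Measure α} {f : α → F} {q : ℝ} (hq : 0 < q) (hf : MemLp f (ENNReal.ofReal q) μ) :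
    ∫⁻ x, ‖f x‖ₑ ^ q ∂μ < ⊤ := by
  have := lintegral_rpow_enorm_lt_top_of_eLpNorm_lt_top (by simpa using hq) (by simp) hf.2
  rwa [ENNReal.toReal_ofReal hq.le] at this

/-- The first order Taylor expansion in `L^q` for restrictions of Sobolev functions on `ℝⁿ`. -/
lemma IsSobolevWith.exists_taylor_restrict (hΩ : IsOpen Ω) {q : ℝ} (hq : 1 ≤ q)
    {v U : EuclideanSpace ℝ (Fin n) → ℝ}
    {H G : EuclideanSpace ℝ (Fin n) → EuclideanSpace ℝ (Fin n)}
    (hv : IsSobolevWith univ (ENNReal.ofReal q) v H) (hvU : v =ᵐ[volume.restrict Ω] U)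
    (hHG : H =ᵐ[volume.restrict Ω] G) {ε : ℝ≥0∞} (hε : 0 < ε) :
    ∃ δ > 0, ∀ h : EuclideanSpace ℝ (Fin n), ‖h‖ < δ →
      ∫⁻ x in Ω ∩ {x | x + h ∈ Ω}, ‖U (x + h) - U x - inner ℝ (G x) h‖ₑ ^ q ≤ ε * ‖h‖ₑ ^ q := by
  have hH : MemLp H (ENNReal.ofReal q) volume := by
    simpa using memLp_of_forall_coord hv.memLp_grad
  set H' := hH.1.mk H
  have hHH' : H =ᵐ[volume] H' := hH.1.ae_eq_mk
  have hw : HasWeakGradient univ v H' := hv.hasWeakGradient.congr (ae_eq_refl _)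
    (by simpa using hHH')
  obtain ⟨δ, hδ, h⟩ := hw.exists_lintegral_enorm_le hH.1.stronglyMeasurable_mk.measurable hq
    ((memLp_congr_ae hHH').1 hH) hε
  refine ⟨δ, hδ, fun k hk => le_trans ?_ (h k hk)⟩
  have hS : MeasurableSet (Ω ∩ {x | x + k ∈ Ω}) :=
    hΩ.measurableSet.inter ((measurable_id.add_const k) hΩ.measurableSet)
  have hvU' := (ae_restrict_iff' hΩ.measurableSet).1 hvU
  have hHG' := (ae_restrict_iff' hΩ.measurableSet).1 hHG
  -- The identity `v = U` is also needed at `x + k`; its null exceptional set is pulled back by the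
  -- translation.
  have hshift := (measurePreserving_add_right volume k).quasiMeasurePreserving.ae hvU'
  refine le_trans (le_of_eq (setLIntegral_congr_fun_ae hS ?_)) (setLIntegral_le_lintegral _ _)
  filter_upwards [hvU', hHG', hshift, hHH'] with x h1 h2 h3 h4 hx
  rw [h1 hx.1, h3 hx.2, ← h4, h2 hx.1]

/-- Uniqueness of weak gradients on `Ω` identifies the gradient of the extension with the prescribed
`G`. -/
lemma IsExtensionDomain.exists_extension (hΩ : IsOpen Ω) {q : ℝ≥0∞} (hext : IsExtensionDomain Ω q)
    {u : EuclideanSpace ℝ (Fin n) → ℝ} (hu : MemSobolev Ω q u)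
    {G : EuclideanSpace ℝ (Fin n) → EuclideanSpace ℝ (Fin n)} (hG : HasWeakGradient Ω u G) :
    ∃ (v : EuclideanSpace ℝ (Fin n) → ℝ)
      (H : EuclideanSpace ℝ (Fin n) → EuclideanSpace ℝ (Fin n)),
      IsSobolevWith univ q v H ∧ v =ᵐ[volume.restrict Ω] u ∧ H =ᵐ[volume.restrict Ω] G := by
  obtain ⟨C, hC⟩ := hext
  obtain ⟨G', hG'⟩ := hu
  obtain ⟨v, H, hv, hvu, -⟩ := hC u G' hG'
  exact ⟨v, H, hv, hvu, HasWeakGradient.ae_eq hΩ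
    ((hv.hasWeakGradient.mono (subset_univ Ω)).congr hvu (ae_eq_refl _)) hG⟩

end Extension

/-! ### Continuity of the moment and identification of the limit -/

section Main

variable {n : ℕ}

lemma continuousAt_sphereMoment (hn : 0 < n) (g : EuclideanSpace ℝ (Fin n)) {q : ℝ} (hq : 0 < q) :
    ContinuousAt (fun q => sphereMoment g q) q := by
  have h1 : ContinuousAt (fun q => q * bbmConst n hn q * ‖g‖ ^ q) q :=
    (continuousAt_id.mul (continuousAt_bbmConst hn hq)).mul
      (Real.continuousAt_const_rpow' hq.ne')
  refine (ENNReal.continuous_ofReal.continuousAt.comp h1).congr ?_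
  filter_upwards [lt_mem_nhds hq] with r hr
  exact (sphereMoment_eq_bbmConst hn g hr).symm

lemma limitDensity_eq (hn : 0 < n)
    (G : EuclideanSpace ℝ (Fin n) → EuclideanSpace ℝ (Fin n))
    {p₀ : EuclideanSpace ℝ (Fin n) → ℝ} {x : EuclideanSpace ℝ (Fin n)} (hp : 0 < p₀ x) :
    limitDensity G p₀ x = ENNReal.ofReal (bbmConst n hn (p₀ x) * ‖G x‖ ^ p₀ x) := by
  rw [limitDensity, sphereMoment_eq_bbmConst hn _ hp, ← ENNReal.ofReal_mul (by positivity)]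
  congr 1
  field_simp

end Main

end VarBBM

end

theorem corollary1p4 (n : ℕ) (hn : 0 < n) (Ω : Set (EuclideanSpace ℝ (Fin n))) (hΩ : IsOpen Ω)
    (p : EuclideanSpace ℝ (Fin n) → EuclideanSpace ℝ (Fin n) → ℝ)
    (hp_meas : AEMeasurable (Function.uncurry p) (volume.restrict (Ω ×ˢ Ω)))
    (hp_bound : VarBBM.ExponentBounds Ω p)
    (hp_log : VarBBM.LogHolder Ω p)
    (hΩ_plus : VarBBM.IsExtensionDomain Ω (VarBBM.pPlus Ω p))
    (hΩ_minus : VarBBM.IsExtensionDomain Ω (VarBBM.pMinus Ω p)) :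
    (∀ u : EuclideanSpace ℝ (Fin n) → ℝ,
      VarBBM.MemSobolev Ω (VarBBM.pPlus Ω p) u → VarBBM.MemSobolev Ω (VarBBM.pMinus Ω p) u →
      ∀ G : EuclideanSpace ℝ (Fin n) → EuclideanSpace ℝ (Fin n), VarBBM.HasWeakGradient Ω u G →
        VarBBM.gradModular hn Ω p G < ⊤ ∧
        Tendsto (fun s : ℝ => VarBBM.fracModular Ω p s u) (𝓝[<] 1)
          (𝓝 (VarBBM.gradModular hn Ω p G))) ∧
    (∀ q : ℝ, 1 < q →
      VarBBM.bbmConst n hn q =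
        2 * Real.pi ^ (((n : ℝ) - 1) / 2) *
          (Real.Gamma ((q + 1) / 2) / Real.Gamma (((n : ℝ) + q) / 2)) * (1 / q)) := by
  refine ⟨fun u hu_plus hu_minus G hG => ?_, fun q hq => VarBBM.bbmConst_eq hn (by linarith)⟩
  have : Nonempty (Fin n) := ⟨⟨0, hn⟩⟩
  obtain ⟨P, hPm, hPa, hPb, hPp⟩ := VarBBM.ExponentBounds.exists_measurable hp_meas hp_bound
  obtain ⟨h1, h2, h3⟩ := hp_bound
  have hm : VarBBM.pMinus Ω p ≠ ⊤ := (h2.trans_lt h3).ne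
  set a := (VarBBM.pMinus Ω p).toReal
  set b := (VarBBM.pPlus Ω p).toReal
  have ha1 : 1 ≤ a := by
    have := ENNReal.toReal_mono hm h1.le
    simpa using this
  have hab : a ≤ b := ENNReal.toReal_mono h3.ne h2
  have ha : 0 < a := by linarith
  have hb : 0 < b := by linarith
  -- The extensions for `p₊` and `p₋` may differ outside `Ω`; inside, both functions agree with `u`
  -- and both gradients with `G` almost everywhere. One pair of measurable representatives `U`, `K`
  -- therefore serves both exponents.
  obtain ⟨v, H, hv, hvu, hHG⟩ := hΩ_plus.exists_extension hΩ hu_plus hG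
  obtain ⟨v', H', hv', hvu', hHG'⟩ := hΩ_minus.exists_extension hΩ hu_minus hG
  rw [← ENNReal.ofReal_toReal h3.ne] at hv
  rw [← ENNReal.ofReal_toReal hm] at hv'
  have hvm : AEStronglyMeasurable v volume := by simpa using hv.memLp.1
  have hHp : MemLp H (ENNReal.ofReal b) volume := by
    simpa using VarBBM.memLp_of_forall_coord hv.memLp_grad
  have hHp' : MemLp H' (ENNReal.ofReal a) volume := by
    simpa using VarBBM.memLp_of_forall_coord hv'.memLp_grad
  set U := hvm.mk v
  set K := hHp.1.mk H
  have hU : Measurable U := hvm.stronglyMeasurable_mk.measurable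
  have hK : Measurable K := hHp.1.stronglyMeasurable_mk.measurable
  have hvU : v =ᵐ[volume.restrict Ω] U := ae_restrict_of_ae hvm.ae_eq_mk
  have hHK : H =ᵐ[volume.restrict Ω] K := ae_restrict_of_ae hHp.1.ae_eq_mk
  have huU : u =ᵐ[volume.restrict Ω] U := hvu.symm.trans hvU
  have hGK : G =ᵐ[volume.restrict Ω] K := hHG.symm.trans hHK
  have hvU' : v' =ᵐ[volume.restrict Ω] U := hvu'.trans huU
  have hHK' : H' =ᵐ[volume.restrict Ω] K := hHG'.trans hGK
  have hUb : ∫⁻ x in Ω, ‖U x‖ₑ ^ b < ⊤ :=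
    VarBBM.MemLp.lintegral_enorm_rpow_lt_top hb ((memLp_congr_ae hvU).1
      ((show MemLp v (ENNReal.ofReal b) volume by simpa using hv.memLp).restrict Ω))
  have hUa : ∫⁻ x in Ω, ‖U x‖ₑ ^ a < ⊤ :=
    VarBBM.MemLp.lintegral_enorm_rpow_lt_top ha ((memLp_congr_ae hvU').1
      ((show MemLp v' (ENNReal.ofReal a) volume by simpa using hv'.memLp).restrict Ω))
  have hKb : ∫⁻ x in Ω, ‖K x‖ₑ ^ b < ⊤ :=
    VarBBM.MemLp.lintegral_enorm_rpow_lt_top hb ((memLp_congr_ae hHK).1 (hHp.restrict Ω))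
  have hKa : ∫⁻ x in Ω, ‖K x‖ₑ ^ a < ⊤ :=
    VarBBM.MemLp.lintegral_enorm_rpow_lt_top ha ((memLp_congr_ae hHK').1 (hHp'.restrict Ω))
  have hess : ∀ᵐ x ∂(volume.restrict Ω), VarBBM.IsEssLimitAt (P x) x (p x x) := by
    filter_upwards [hPp, ae_restrict_mem hΩ.measurableSet] with x hx hxΩ
    exact hp_log.isEssLimitAt hΩ hxΩ hx
  have hc : ∀ (g : EuclideanSpace ℝ (Fin n)) (q : ℝ), 0 < q →
      ContinuousAt (fun q => VarBBM.sphereMoment g q) q :=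
    fun g q hq => VarBBM.continuousAt_sphereMoment hn g hq
  have htaylor : ∀ q ∈ ({a, b} : Set ℝ), ∀ ε : ℝ≥0∞, 0 < ε →
      ∃ δ > 0, ∀ h : EuclideanSpace ℝ (Fin n), ‖h‖ < δ →
        ∫⁻ x in Ω ∩ {x | x + h ∈ Ω}, ‖U (x + h) - U x - inner ℝ (K x) h‖ₑ ^ q ≤
          ε * ‖h‖ₑ ^ q := by
    rintro q (rfl | rfl) ε hε
    · exact hv'.exists_taylor_restrict hΩ ha1 hvU' hHK' hε
    · exact hv.exists_taylor_restrict hΩ (ha1.trans hab) hvU hHK hε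
  have hgrad : VarBBM.gradModular hn Ω p G =
      ∫⁻ x in Ω, VarBBM.limitDensity K (fun x => p x x) x := by
    refine lintegral_congr_ae ?_
    filter_upwards [hess, hGK] with x hx hGx
    rw [VarBBM.limitDensity_eq hn K (p₀ := fun x => p x x)
      (ha.trans_le (hx.mem_Icc (hPa x) (hPb x)).1), hGx]
  -- The modular sees `p` and `u` only up to null sets, so it may be computed with `P` and `U`.
  have hfrac : ∀ s : ℝ, VarBBM.fracModular Ω p s u = ENNReal.ofReal (s * (1 - s)) *
      ∫⁻ x in Ω, ∫⁻ y in Ω, ENNReal.ofReal (|U x - U y| ^ P x y /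
        ‖x - y‖ ^ (Module.finrank ℝ (EuclideanSpace ℝ (Fin n)) + s * P x y)) := by
    intro s
    rw [VarBBM.fracModular]
    congr 1
    refine lintegral_congr_ae ?_
    filter_upwards [hPp, huU] with x hx hux
    refine lintegral_congr_ae ?_
    filter_upwards [hx, huU] with y hy huy
    rw [finrank_euclideanSpace_fin, hy, hux, huy]
  rw [hgrad]
  simp_rw [hfrac]
  exact ⟨(VarBBM.tendsto_nearModular_gradQuotient hΩ ha hPm hPa hPb hK hKa hKb hess hc).1,
    VarBBM.tendsto_fractional_modular hΩ ha hPm hPa hPb hU hUa hUb hK hKa hKb hess hc htaylor⟩
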